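/- Let $n\ge 1$ and $\beta>0$. Let $\Phi_n(x)=|x|$ on $\mathbb R^n$, let $\mu_n=c_n\mathscr L^n|_{B(0,1)}$ be the normalized Lebesgue measure on the unit ball of $\mathbb R^n$, let $\nu_n:=(\Phi_n)_\#\mu_n$, and let $S_n(y):=(n-1)\log y$ for $y>0$. Let $X$ be flat diffusion in the unit ball with reflecting boundary conditions, $dX_t=\sqrt{2/\beta}\,dW_t$ in $B(0,1)$ with $W$ an $n$-dimensional Brownian motion; that is, $X$ is a continuous adapted process in the closed unit ball with $X_t=X_0+\sqrt{2/\beta}\,W_t-\int_0^t X_s\,dL_s$, where $L$ is adapted, continuous, nondecreasing and increases only when $|X_t|=1$. Let $Y_t:=\Phi_n(X_t)=|X_t|$. Then: 1. $\nu_n$ is an invariant measure of $Y$: for every such process $X$ (with any initial law), if $Y_0$ has law $\nu_n$, then $Y_t$ has law $\nu_n$ for all $t\ge0$. 2. $\nu_n$ is a probability measure, and $\nu_n(dy)=c_n'\,e^{S_n(y)}\,\mathbf 1_{(0,1)}(y)\,dy$ for a normalization constant $c_n'>0$. 3. There is a constant $C_{1,n}\in\mathbb R$ such that $S_n(y)=\log\frac{d(\Phi_n)_\#\mu_n}{d\mathscr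 L^1}(y)+C_{1,n}$ for almost every $y\in(0,1)$. 4. There is a constant $C_{2,n}\in\mathbb R$ such that $S_n(y)=\log\int_{\mathbb R^n}\delta[\Phi_n(x)-y](dx)+C_{2,n}$ for $y>0$, where $\delta[\Phi_n(x)-y](dx)$ is the microcanonical measure. This holds, and the measures in question exist, in both of the following senses: (a) for almost every $y>0$, if $\delta[\Phi_n(x)-a]$, $a\in\mathbb R$, is any family of measures, locally finite for almost every $a$, such that $\int_{\mathbb R}G(a)\int_{\mathbb R^n}F(x)\,\delta[\Phi_n(x)-a](dx)\,da=\int_{\mathbb R^n}G(\Phi_n(x))F(x)\,dx$ (with integrable outer integrand on the left) for all $F\in C_c(\mathbb R^n)$ and $G\in C(\mathbb R)$; (b) for every $y>0$, if $\delta[\Phi_n(x)-y]$ is the locally finite measure given by $\int\varphi(x)\,\delta[\Phi_n(x)-y](dx)=\lim_{h\downarrow0}\frac1h\int_{\{y\le\Phi_n(x)<y+h\}}\varphi(x)\,dx$ for all $\varphi\in C_c(\mathbb R^n)$. -/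

import Mathlib

open MeasureTheory ProbabilityTheory Filter Topology
open scoped NNReal ENNReal

namespace CoarseGraining

/-- `W` is an `n`-dimensional Brownian motion started at `0`, relative to the filtration `𝓕`:
it is adapted, its coordinates are independent real Brownian motions, and its increments after
time `s` are independent of `𝓕 s`. -/
structure IsBrownian {n : ℕ} {Ω : Type*} {mΩ : MeasurableSpace Ω} (P : Measure Ω)
    (𝓕 : Filtration ℝ≥0 mΩ) (W : ℝ≥0 → Ω → EuclideanSpace ℝ (Fin n)) : Prop where
  adapted : ∀ t, Measurable[𝓕 t] (W t)
  coord : ∀ i, IsBrownianReal (fun t ω => W t ω i) P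
  indep_coord : iIndepFun (fun (i : Fin n) (ω : Ω) (t : ℝ≥0) => W t ω i) P
  indep_increment : ∀ s t, s ≤ t →
    Indep (MeasurableSpace.comap (fun ω => W t ω - W s ω) inferInstance) (𝓕 s) P

/-- `X`, with boundary local time measure `L` (so `L ω` is the random measure `dL_t` on time),
solves the Skorokhod equation in the closed unit ball of `ℝⁿ`,
`dX_t = √(2/β) dW_t - X_t dL_t`, where `L` is continuous, nondecreasing, adapted, and increases
only when `X` is on the unit sphere. The inward unit normal at a boundary point `x` is `-x`, so
this is `dX_t = √(2/β) dW_t` with (normally) reflecting boundary conditions. -/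
structure IsReflectedSolution {n : ℕ} (β : ℝ) {Ω : Type*} {mΩ : MeasurableSpace Ω}
    (P : Measure Ω) (𝓕 : Filtration ℝ≥0 mΩ) (W : ℝ≥0 → Ω → EuclideanSpace ℝ (Fin n))
    (L : Ω → Measure ℝ≥0) (X : ℝ≥0 → Ω → EuclideanSpace ℝ (Fin n)) : Prop where
  brownian : IsBrownian P 𝓕 W
  adapted : ∀ t, Measurable[𝓕 t] (X t)
  continuous_paths : ∀ᵐ ω ∂P, Continuous (fun t => X t ω)
  mem_ball : ∀ᵐ ω ∂P, ∀ t, ‖X t ω‖ ≤ 1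
  localTime_adapted : ∀ t, Measurable[𝓕 t] (fun ω => L ω (Set.Iic t))
  localTime_finite : ∀ᵐ ω ∂P, ∀ t, L ω (Set.Iic t) < ∞
  localTime_continuous : ∀ᵐ ω ∂P, ∀ t, L ω {t} = 0
  localTime_boundary : ∀ᵐ ω ∂P, L ω {t | ‖X t ω‖ < 1} = 0
  equation : ∀ᵐ ω ∂P, ∀ t,
    X t ω = X 0 ω + √(2 / β) • W t ω - ∫ s in Set.Iic t, X s ω ∂(L ω)

/-- `X` is a flat diffusion with mobility parameter `β` in the closed unit ball of `ℝⁿ` with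
reflecting boundary conditions, with an arbitrary initial law. -/
def IsReflectedFlatDiffusion {n : ℕ} (β : ℝ) {Ω : Type*} {mΩ : MeasurableSpace Ω}
    (P : Measure Ω) (X : ℝ≥0 → Ω → EuclideanSpace ℝ (Fin n)) : Prop :=
  ∃ (𝓕 : Filtration ℝ≥0 mΩ) (W : ℝ≥0 → Ω → EuclideanSpace ℝ (Fin n)) (L : Ω → Measure ℝ≥0),
    IsReflectedSolution β P 𝓕 W L X

/-- The coarse-graining map `Φ_n(x) = |x|`. -/
noncomputable def Phi (n : ℕ) (x : EuclideanSpace ℝ (Fin n)) : ℝ := ‖x‖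

/-- The normalized Lebesgue measure on the unit ball of `ℝⁿ`. -/
noncomputable def mu (n : ℕ) : Measure (EuclideanSpace ℝ (Fin n)) :=
  (volume (Metric.ball (0 : EuclideanSpace ℝ (Fin n)) 1))⁻¹ •
    volume.restrict (Metric.ball (0 : EuclideanSpace ℝ (Fin n)) 1)

/-- The push-forward of `mu n` under `Phi n`. -/
noncomputable def nu (n : ℕ) : Measure ℝ := (mu n).map (Phi n)

/-- The entropy `S_n(y) = (n-1) log y`, used for `y > 0`. -/
noncomputable def S (n : ℕ) (y : ℝ) : ℝ := ((n : ℝ) - 1) * Real.log y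

/-- `δ a` is the microcanonical measure `δ[f(x) - a]` for almost every `a`: the `δ a` are locally
finite measures disintegrating Lebesgue measure along `f`. -/
structure IsMicrocanonical {n : ℕ} (f : EuclideanSpace ℝ (Fin n) → ℝ)
    (δ : ℝ → Measure (EuclideanSpace ℝ (Fin n))) : Prop where
  locallyFinite : ∀ᵐ a : ℝ, IsLocallyFiniteMeasure (δ a)
  integrable : ∀ (F : EuclideanSpace ℝ (Fin n) → ℝ) (G : ℝ → ℝ), Continuous F →
    HasCompactSupport F → Continuous G → Integrable (fun a => G a * ∫ x, F x ∂(δ a))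
  integral_eq : ∀ (F : EuclideanSpace ℝ (Fin n) → ℝ) (G : ℝ → ℝ), Continuous F →
    HasCompactSupport F → Continuous G →
    ∫ a, G a * ∫ x, F x ∂(δ a) = ∫ x, G (f x) * F x

/-- `m` is the microcanonical measure `δ[f(x) - y]` at the given level `y`, obtained as the limit
of Lebesgue measure on the shells `{y ≤ f < y + h}` divided by their thickness `h`, tested against
continuous functions with compact support. -/
structure IsMicrocanonicalAt {n : ℕ} (f : EuclideanSpace ℝ (Fin n) → ℝ) (y : ℝ)
    (m : Measure (EuclideanSpace ℝ (Fin n))) : Prop where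
  locallyFinite : IsLocallyFiniteMeasure m
  tendsto : ∀ φ : EuclideanSpace ℝ (Fin n) → ℝ, Continuous φ → HasCompactSupport φ →
    Tendsto (fun h : ℝ => h⁻¹ * ∫ x in {x | y ≤ f x ∧ f x < y + h}, φ x) (𝓝[>] 0)
      (𝓝 (∫ x, φ x ∂m))

end CoarseGraining

/-!
The statements on `ν_n` and on the microcanonical measures are integration in polar coordinates
(`integral_polar`): `ν_n` has the density `n y ^ (n - 1)` on `(0, 1)`, and the microcanonical
measure at the level `a > 0` is the surface measure of the sphere of radius `a`, of mass
proportional to `a ^ (n - 1)`. Uniqueness of the total mass, in either sense, comes from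
testing against radial cut-offs that increase to `1`.

The invariance of `ν_n` is a statement about an arbitrary weak solution whose initial law has a
prescribed radial part but need not be rotation invariant. It is proved through the moments
`a_k(t) = E ‖X_t‖ ^ (2k)`. Itô's formula for `‖x‖ ^ (2k)` reads, in expectation,
`a_k(t) = a_k(0) + (2/β) k (n + 2k - 2) ∫₀ᵗ a_{k-1} - 2 k E L_t`,
because `X · X dL = dL` on the sphere. The moments `n / (n + 2k)` of `ν_n` solve the same hierarchy
with `E L_t` replaced by `n t / β`. Hence the differences `b_k` are bounded by `1` uniformly in `k`,
start from `0`, and satisfy `b_k = c_k ∫ b_{k-1} + k b_1` once `E L_t` is eliminated by means of the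
equation for `k = 1`. Such a family vanishes (`moment_hierarchy_eq_zero`): after a Laplace transform
the hierarchy telescopes, and the growth of `c_k` forces the transform of `b_1` to be zero. Even
moments determine a measure on `[0, 1]` (`measure_eq_of_even_moments`), so the law of `‖X_t‖` is
`ν_n`.

Itô's formula is obtained without stochastic integrals. On uniform partitions, the second order
Taylor expansion of `p (‖x‖ ^ 2)` along the increments of `X` splits into a martingale sum, a
compensated quadratic variation, Riemann sums, Riemann-Stieltjes sums against the boundary term,
and a remainder. The compensated quadratic variation tends to zero in `L²`, hence almost surely along a
subsequence of partitions, and there the remainder vanishes pathwise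
(`tendsto_pathwise_expansion`). So the centred martingale sums converge almost surely, and since
they are bounded in `L²` their expectations converge too (`integral_expansion`); in particular the
local time is integrable without any a priori bound.
-/

namespace CoarseGraining

/-! ### Laplace transforms and the uniqueness of bounded moment hierarchies -/

theorem integrableOn_exp_neg_mul_of_bounded {α K : ℝ} (hα : 0 < α) {b : ℝ → ℝ}
    (hb : Continuous b) (hK : ∀ t, |b t| ≤ K) :
    IntegrableOn (fun t => Real.exp (-α * t) * b t) (Set.Ioi 0) := by
  have h := (exp_neg_integrableOn_Ioi 0 hα).mul_const K
  refine Integrable.mono' h (by fun_prop) (ae_of_all _ fun t => ?_)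
  rw [Real.norm_eq_abs, abs_mul, Real.abs_exp]
  exact mul_le_mul_of_nonneg_left (hK t) (Real.exp_pos _).le

theorem abs_laplace_le {α K : ℝ} (hα : 0 < α) {b : ℝ → ℝ} (hK : ∀ t, |b t| ≤ K) :
    |∫ t in Set.Ioi 0, Real.exp (-α * t) * b t| ≤ K / α := by
  have h := (exp_neg_integrableOn_Ioi 0 hα).mul_const K
  have h2 : ∫ t in Set.Ioi (0:ℝ), Real.exp (-α * t) * K = K / α := by
    rw [integral_mul_const, integral_exp_mul_Ioi (by linarith)]
    field_simp
    simp
  rw [← h2, ← Real.norm_eq_abs]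
  refine norm_integral_le_of_norm_le h (ae_of_all _ fun t => ?_)
  rw [Real.norm_eq_abs, abs_mul, Real.abs_exp]
  exact mul_le_mul_of_nonneg_left (hK t) (Real.exp_pos _).le

/-- Injectivity of the Laplace transform, sampled at the positive integers: after the substitution
`x = exp (-t)` this is the Weierstrass approximation theorem for the function
`x ↦ x * b (-log x)`. -/
theorem eq_zero_of_laplace_eq_zero {K : ℝ} {b : ℝ → ℝ} (hb : Continuous b)
    (hK : ∀ t, |b t| ≤ K)
    (h : ∀ m : ℕ, ∫ t in Set.Ioi 0, Real.exp (-(m + 1 : ℝ) * t) * b t = 0) :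
    ∀ t, 0 ≤ t → b t = 0 := by
  have hK0 : 0 ≤ K := (abs_nonneg _).trans (hK 0)
  have hcont : Continuous fun x : ℝ => x * b (-Real.log x) := by
    rw [continuous_iff_continuousAt]
    intro x
    rcases eq_or_ne x 0 with rfl | hx
    · have h1 : Tendsto (fun x : ℝ => K * |x|) (𝓝 0) (𝓝 0) := by
        have : Continuous fun x : ℝ => K * |x| := by fun_prop
        simpa using this.tendsto 0
      rw [ContinuousAt, zero_mul]
      refine squeeze_zero_norm (fun y => ?_) h1
      rw [Real.norm_eq_abs, abs_mul, mul_comm]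
      exact mul_le_mul_of_nonneg_right (hK _) (abs_nonneg _)
    · exact continuousAt_id.mul (hb.continuousAt.comp (Real.continuousAt_log hx).neg)
  have hint := fun m : ℕ =>
    integrableOn_exp_neg_mul_of_bounded (α := (m + 1 : ℝ)) (by positivity) hb hK
  have hexp : ∀ (m : ℕ) (t : ℝ), 
      Real.exp (-(m + 1 : ℝ) * t) = Real.exp (-t) * Real.exp (-t) ^ m := by
    intro m t
    rw [← Real.exp_nat_mul, ← Real.exp_add]
    ring_nf
  have hpoly : ∀ p : Polynomial ℝ,
      ∫ t in Set.Ioi 0, Real.exp (-t) * b t * p.eval (Real.exp (-t)) = 0 := by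
    intro p
    have h1 : ∀ t, Real.exp (-t) * b t * p.eval (Real.exp (-t)) =
        ∑ m ∈ Finset.range (p.natDegree + 1),
          p.coeff m * (Real.exp (-(m + 1 : ℝ) * t) * b t) := by
      intro t
      rw [Polynomial.eval_eq_sum_range, Finset.mul_sum]
      refine Finset.sum_congr rfl fun m _ => ?_
      rw [hexp]
      ring
    simp_rw [h1]
    rw [integral_finsetSum _ fun m _ => (hint m).const_mul _]
    refine Finset.sum_eq_zero fun m _ => ?_
    rw [integral_const_mul, h m, mul_zero]
  have h0 := hint 0
  simp only [Nat.cast_zero, zero_add, neg_mul, one_mul] at h0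
  have hi2 : IntegrableOn (fun t => (Real.exp (-t) * b t) ^ 2) (Set.Ioi 0) := by
    simp_rw [sq]
    refine Integrable.mul_bdd (c := K) h0 (by fun_prop) ?_
    refine (ae_restrict_mem measurableSet_Ioi).mono fun t ht => ?_
    rw [Real.norm_eq_abs, abs_mul, Real.abs_exp]
    have : Real.exp (-t) ≤ 1 := by simpa using (le_of_lt ht)
    nlinarith [hK t, abs_nonneg (b t), Real.exp_pos (-t)]
  -- Replace one factor `exp (-t) * b t` by a polynomial in `exp (-t)` close to it.
  have hsq : ∫ t in Set.Ioi 0, (Real.exp (-t) * b t) ^ 2 = 0 := by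
    rw [← abs_nonpos_iff]
    refine le_of_forall_pos_le_add fun ε hε => ?_
    obtain ⟨p, hp⟩ := exists_polynomial_near_of_continuousOn 0 1 _ hcont.continuousOn
      (ε / (K + 1)) (by positivity)
    have hbd : ∀ t : ℝ, 0 < t →
        |b t * ((Real.exp (-t) * b t) - p.eval (Real.exp (-t)))| ≤ K * (ε / (K + 1)) := by
      intro t ht
      have h2 := hp (Real.exp (-t)) ⟨(Real.exp_pos _).le, by simpa using ht.le⟩
      rw [Real.log_exp, neg_neg, abs_sub_comm] at h2
      rw [abs_mul]
      exact mul_le_mul (hK t) h2.le (abs_nonneg _) hK0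
    have hi1 : IntegrableOn (fun t => Real.exp (-t) * b t * p.eval (Real.exp (-t)))
        (Set.Ioi 0) := by
      refine Integrable.mul_bdd (c := sSup ((fun x => |p.eval x|) '' Set.Icc 0 1)) h0
        (by have := p.continuous; fun_prop) ?_
      refine (ae_restrict_mem measurableSet_Ioi).mono fun t ht => ?_
      refine le_csSup ?_ ⟨_, ⟨(Real.exp_pos _).le, by simpa using (le_of_lt ht)⟩, rfl⟩
      exact (isCompact_Icc.image (p.continuous.abs)).bddAbove
    have h3 : ∫ t in Set.Ioi 0, (Real.exp (-t) * b t) ^ 2 =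
        ∫ t in Set.Ioi 0,
          Real.exp (-t) * (b t * ((Real.exp (-t) * b t) - p.eval (Real.exp (-t)))) := by
      have e := integral_sub hi2 hi1
      rw [hpoly p, sub_zero] at e
      rw [← e]
      refine integral_congr_ae (ae_of_all _ fun t => ?_)
      simp only
      ring
    rw [h3, zero_add, ← Real.norm_eq_abs]
    have h4 := (exp_neg_integrableOn_Ioi 0 one_pos).mul_const (K * (ε / (K + 1)))
    refine (norm_integral_le_of_norm_le h4 ?_).trans ?_
    · refine (ae_restrict_mem measurableSet_Ioi).mono fun t ht => ?_
      rw [Real.norm_eq_abs, abs_mul, Real.abs_exp, neg_mul, one_mul]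
      exact mul_le_mul_of_nonneg_left (hbd t ht) (Real.exp_pos _).le
    · rw [integral_mul_const, integral_exp_mul_Ioi (by norm_num)]
      simp only [mul_zero, Real.exp_zero]
      have : K * (ε / (K + 1)) ≤ ε := by
        rw [mul_div_assoc', div_le_iff₀ (by positivity)]
        nlinarith
      linarith
  have hae : (fun t => (Real.exp (-t) * b t) ^ 2) =ᵐ[volume.restrict (Set.Ioi 0)] 0 := by
    exact (integral_eq_zero_iff_of_nonneg (fun t => sq_nonneg _) hi2).1 hsq
  have hon : Set.EqOn (fun t => (Real.exp (-t) * b t) ^ 2) 0 (Set.Ioi 0) :=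
    Measure.eqOn_open_of_ae_eq hae isOpen_Ioi (by fun_prop) continuousOn_const
  have hon2 : Set.EqOn (fun t => (Real.exp (-t) * b t) ^ 2) 0 (Set.Ici 0) := by
    rw [← closure_Ioi]
    exact hon.closure (by fun_prop) continuous_const
  intro t ht
  have := hon2 ht
  simpa [Real.exp_ne_zero] using this

/-- Laplace transform of the integral equation `f t = f 0 + ∫₀ᵗ g`, for `f 0 = 0`. -/
theorem laplace_integral {α K K' : ℝ} (hα : 0 < α) {f g : ℝ → ℝ} (hf : Continuous f)
    (hg : Continuous g) (hK : ∀ t, |f t| ≤ K) (hK' : ∀ t, |g t| ≤ K')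
    (h : ∀ t, 0 ≤ t → f t = ∫ s in (0 : ℝ)..t, g s) :
    α * ∫ t in Set.Ioi 0, Real.exp (-α * t) * f t =
      ∫ t in Set.Ioi 0, Real.exp (-α * t) * g t := by
  have hif := integrableOn_exp_neg_mul_of_bounded hα hf hK
  have hig := integrableOn_exp_neg_mul_of_bounded hα hg hK'
  have hd : ∀ t ∈ Set.Ioi (0 : ℝ), HasDerivAt (fun t => Real.exp (-α * t) * f t)
      (Real.exp (-α * t) * g t - α * (Real.exp (-α * t) * f t)) t := by
    intro t ht
    have h1 : HasDerivAt f (g t) t := by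
      refine (intervalIntegral.integral_hasDerivAt_right (hg.intervalIntegrable 0 t)
        hg.aestronglyMeasurable.stronglyMeasurableAtFilter hg.continuousAt).congr_of_eventuallyEq ?_
      filter_upwards [Ioi_mem_nhds ht] with s hs
      exact h s (le_of_lt hs)
    have h2 : HasDerivAt (fun t => Real.exp (-α * t)) (Real.exp (-α * t) * (-α)) t := by
      simpa using ((hasDerivAt_id t).const_mul (-α)).exp
    exact (h2.mul h1).congr_deriv (by ring)
  have hlim : Tendsto (fun t => Real.exp (-α * t) * f t) atTop (𝓝 0) := by
    have h1 : Tendsto (fun t => Real.exp (-α * t) * K) atTop (𝓝 0) := by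
      have : Tendsto (fun t => Real.exp (-α * t)) atTop (𝓝 0) := by
        exact Real.tendsto_exp_atBot.comp
          ((tendsto_id (α := ℝ)).const_mul_atTop_of_neg (neg_lt_zero.2 hα))
      simpa using this.mul_const K
    refine squeeze_zero_norm (fun t => ?_) h1
    rw [Real.norm_eq_abs, abs_mul, Real.abs_exp]
    exact mul_le_mul_of_nonneg_left (hK t) (Real.exp_pos _).le
  have key := integral_Ioi_of_hasDerivAt_of_tendsto (a := 0) (by fun_prop) hd
    (hig.sub (hif.const_mul α)) hlim
  rw [integral_sub hig (hif.const_mul α), integral_const_mul] at key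
  have h0 : f 0 = 0 := by simpa using h 0 le_rfl
  simp only [h0, mul_zero, sub_zero] at key
  linarith

/-- Uniqueness for the moment hierarchy: a uniformly bounded solution of
`b_{k+1} = c_k ∫ b_k + (k+1) b_1`, `b_0 = 0`, vanishes as soon as `c_k → ∞`. On the Laplace side,
at parameter `α`, the hierarchy telescopes with the weights `α ^ k / (c_0 ⋯ c_{k-1})`; these tend
to `0`, while the coefficient that multiplies the transform of `b_1` stays bounded below. -/
theorem moment_hierarchy_eq_zero {K : ℝ} {b : ℕ → ℝ → ℝ} {c : ℕ → ℝ}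
    (hb : ∀ k, Continuous (b k)) (hK : ∀ k t, |b k t| ≤ K) (hc : ∀ k, 0 < c k)
    (hlim : Tendsto c atTop atTop) (h0 : ∀ t, b 0 t = 0)
    (h : ∀ k t, 0 ≤ t → b (k + 1) t = c k * (∫ s in (0 : ℝ)..t, b k s) + (k + 1) * b 1 t) :
    ∀ k t, 0 ≤ t → b k t = 0 := by
  have hb1 : ∀ t, 0 ≤ t → b 1 t = 0 := by
    refine eq_zero_of_laplace_eq_zero (hb 1) (hK 1) fun m => ?_
    have hα : (0 : ℝ) < m + 1 := by positivity
    set α : ℝ := m + 1 with hαdef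
    set Lp : ℕ → ℝ := fun k => ∫ t in Set.Ioi 0, Real.exp (-α * t) * b k t with hLp
    have hrec : ∀ k : ℕ, Lp (k + 1) = c k / α * Lp k + (k + 1) * Lp 1 := by
      intro k
      have e := laplace_integral (f := fun t => b (k + 1) t - (k + 1) * b 1 t)
        (g := fun t => c k * b k t) (K := K + (k + 1) * K) (K' := c k * K) hα
        ((hb _).sub ((hb 1).const_mul _)) ((hb k).const_mul _)
        (fun t => by
          refine (abs_sub _ _).trans (add_le_add (hK _ _) ?_)
          rw [abs_mul, abs_of_nonneg (by positivity : (0 : ℝ) ≤ k + 1)]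
          exact mul_le_mul_of_nonneg_left (hK _ _) (by positivity))
        (fun t => by
          rw [abs_mul, abs_of_pos (hc k)]
          exact mul_le_mul_of_nonneg_left (hK _ _) (hc k).le)
        (fun t ht => by
          rw [h k t ht, intervalIntegral.integral_const_mul]
          ring)
      have i1 := integrableOn_exp_neg_mul_of_bounded hα (hb (k + 1)) (hK (k + 1))
      have i2 := integrableOn_exp_neg_mul_of_bounded hα (hb 1) (hK 1)
      have e1 : ∫ t in Set.Ioi 0, Real.exp (-α * t) * (b (k + 1) t - (k + 1) * b 1 t) =
          Lp (k + 1) - (k + 1) * Lp 1 := by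
        rw [hLp]
        simp only
        rw [← integral_const_mul, ← integral_sub i1 (i2.const_mul _)]
        refine integral_congr_ae (ae_of_all _ fun t => ?_)
        simp only
        ring
      have e2 : ∫ t in Set.Ioi 0, Real.exp (-α * t) * (c k * b k t) = c k * Lp k := by
        rw [hLp]
        simp only
        rw [← integral_const_mul]
        refine integral_congr_ae (ae_of_all _ fun t => ?_)
        simp only
        ring
      rw [e1, e2] at e
      field_simp
      linarith
    have hL0 : Lp 0 = 0 := by simp [hLp, h0]
    set w : ℕ → ℝ := fun k => ∏ j ∈ Finset.range k, (α / c j) with hw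
    have hwpos : ∀ k, 0 < w k := fun k => Finset.prod_pos fun j _ => div_pos hα (hc j)
    have hws : ∀ k, w (k + 1) = w k * (α / c k) := fun k => Finset.prod_range_succ _ _
    have htel : ∀ N, w N * Lp N = Lp 1 * ∑ k ∈ Finset.range N, ((k : ℝ) + 1) * w (k + 1) := by
      intro N
      induction N with
      | zero => simp [hL0]
      | succ N ih =>
        rw [Finset.sum_range_succ, mul_add, ← ih, hrec N, hws]
        have := (hc N).ne'
        field_simp
    have hwlim : Tendsto w atTop (𝓝 0) := by
      refine (summable_of_ratio_test_tendsto_lt_one (l := 0) one_pos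
        (Eventually.of_forall fun k => (hwpos k).ne') ?_).tendsto_atTop_zero
      have : Tendsto (fun k => α / c k) atTop (𝓝 0) := hlim.const_div_atTop α
      refine this.congr fun k => ?_
      rw [hws, norm_mul, mul_div_cancel_left₀ _ (norm_ne_zero_iff.2 (hwpos k).ne'),
        Real.norm_of_nonneg (div_pos hα (hc k)).le]
    -- All terms of the sum in `htel` are nonnegative, so its first term bounds it from below.
    have hbound : ∀ N, |Lp 1| * w 1 ≤ w (N + 1) * (K / α) := by
      intro N
      have h1 : w 1 ≤ ∑ k ∈ Finset.range (N + 1), ((k : ℝ) + 1) * w (k + 1) := by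
        have := Finset.single_le_sum (f := fun k : ℕ => ((k : ℝ) + 1) * w (k + 1))
          (fun i _ => mul_nonneg (by positivity) (hwpos _).le) (Finset.mem_range.2 N.succ_pos)
        simpa using this
      calc |Lp 1| * w 1 ≤ |Lp 1| * ∑ k ∈ Finset.range (N + 1), ((k : ℝ) + 1) * w (k + 1) :=
            mul_le_mul_of_nonneg_left h1 (abs_nonneg _)
        _ = |w (N + 1) * Lp (N + 1)| := by
            rw [htel, abs_mul, abs_of_nonneg (Finset.sum_nonneg fun i _ =>
              mul_nonneg (by positivity) (hwpos _).le)]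
        _ ≤ w (N + 1) * (K / α) := by
            rw [abs_mul, abs_of_pos (hwpos _)]
            exact mul_le_mul_of_nonneg_left (abs_laplace_le hα (hK _)) (hwpos _).le
    have hle : |Lp 1| * w 1 ≤ 0 := by
      have := ((tendsto_add_atTop_iff_nat 1).2 hwlim).mul_const (K / α)
      rw [zero_mul] at this
      exact ge_of_tendsto' this hbound
    have : |Lp 1| ≤ 0 := by
      by_contra hcon
      exact absurd hle (not_le.2 (mul_pos (not_le.1 hcon) (hwpos 1)))
    exact abs_nonpos_iff.1 this
  intro k
  induction k with
  | zero => exact fun t _ => h0 t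
  | succ k ih =>
    intro t ht
    rw [h k t ht, hb1 t ht, mul_zero, add_zero,
      intervalIntegral.integral_congr (g := fun _ => (0 : ℝ)) fun s hs => ?_]
    · simp
    · rw [Set.uIcc_of_le ht] at hs
      exact ih s hs.1

/-- A finite measure on `[0, 1]` is determined by its even moments, since by Weierstrass'
approximation polynomials in `y ^ 2` are uniformly dense in the continuous functions on `[0, 1]`. -/
theorem measure_eq_of_even_moments {μ ν : Measure ℝ} [IsFiniteMeasure μ] [IsFiniteMeasure ν]
    (hμ : ∀ᵐ y ∂μ, y ∈ Set.Icc (0 : ℝ) 1) (hν : ∀ᵐ y ∂ν, y ∈ Set.Icc (0 : ℝ) 1)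
    (h : ∀ k : ℕ, ∫ y, (y ^ 2) ^ k ∂μ = ∫ y, (y ^ 2) ^ k ∂ν) : μ = ν := by
  have hpow : ∀ (ρ : Measure ℝ) [IsFiniteMeasure ρ], (∀ᵐ y ∂ρ, y ∈ Set.Icc (0 : ℝ) 1) →
      ∀ k : ℕ, Integrable (fun y : ℝ => (y ^ 2) ^ k) ρ := by
    intro ρ _ hρ k
    refine Integrable.mono' (integrable_const (1 : ℝ)) (by fun_prop) (hρ.mono fun y hy => ?_)
    rw [Real.norm_of_nonneg (by positivity)]
    exact pow_le_one₀ (sq_nonneg _) (pow_le_one₀ hy.1 hy.2)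
  have hexp : ∀ (p : Polynomial ℝ) (y : ℝ), p.eval (y ^ 2) =
      ∑ m ∈ Finset.range (p.natDegree + 1), p.coeff m * (y ^ 2) ^ m :=
    fun p y => Polynomial.eval_eq_sum_range _
  have hpi : ∀ (ρ : Measure ℝ) [IsFiniteMeasure ρ], (∀ᵐ y ∂ρ, y ∈ Set.Icc (0 : ℝ) 1) →
      ∀ p : Polynomial ℝ, Integrable (fun y : ℝ => p.eval (y ^ 2)) ρ := by
    intro ρ _ hρ p
    simp_rw [hexp]
    exact integrable_finsetSum _ fun m _ => (hpow ρ hρ m).const_mul _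
  have hpoly : ∀ p : Polynomial ℝ, ∫ y, p.eval (y ^ 2) ∂μ = ∫ y, p.eval (y ^ 2) ∂ν := by
    intro p
    simp_rw [hexp]
    rw [integral_finsetSum _ fun m _ => (hpow μ hμ m).const_mul _,
      integral_finsetSum _ fun m _ => (hpow ν hν m).const_mul _]
    refine Finset.sum_congr rfl fun m _ => ?_
    rw [integral_const_mul, integral_const_mul, h m]
  refine ext_of_forall_integral_eq_of_IsFiniteMeasure fun f => ?_
  rw [← sub_eq_zero, ← abs_nonpos_iff]
  refine le_of_forall_pos_le_add fun ε hε => ?_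
  set Z : ℝ := μ.real Set.univ + ν.real Set.univ + 1
  have hZ : 0 < Z := by positivity
  obtain ⟨p, hp⟩ := exists_polynomial_near_of_continuousOn 0 1 (fun s => f (√s))
    (by fun_prop) (ε / Z) (by positivity)
  have hest : ∀ (ρ : Measure ℝ) [IsFiniteMeasure ρ], (∀ᵐ y ∂ρ, y ∈ Set.Icc (0 : ℝ) 1) →
      |∫ y, f y ∂ρ - ∫ y, p.eval (y ^ 2) ∂ρ| ≤ ε / Z * ρ.real Set.univ := by
    intro ρ _ hρ
    rw [← integral_sub (f.integrable ρ) (hpi ρ hρ p), ← Real.norm_eq_abs]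
    refine norm_integral_le_of_norm_le_const (hρ.mono fun y hy => ?_)
    have := hp (y ^ 2) ⟨sq_nonneg _, pow_le_one₀ hy.1 hy.2⟩
    rw [Real.sqrt_sq hy.1] at this
    rw [Real.norm_eq_abs, abs_sub_comm]
    exact this.le
  have h1 := hest μ hμ
  have h2 := hest ν hν
  rw [hpoly p] at h1
  have h3 : ε / Z * μ.real Set.univ + ε / Z * ν.real Set.univ ≤ ε := by
    rw [← mul_add, div_mul_eq_mul_div, div_le_iff₀ hZ]
    exact mul_le_mul_of_nonneg_left (by simp [Z]) hε.le
  rw [zero_add]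
  rw [abs_le] at h1 h2 ⊢
  constructor <;> linarith

/-! ### Polar coordinates, the law of the radius and microcanonical measures -/

/-- Integration in polar coordinates for functions that need not be radial. -/
theorem integral_polar {n : ℕ} (hn : 1 ≤ n) {H : EuclideanSpace ℝ (Fin n) → ℝ} (hH : Integrable H) :
    IntegrableOn (fun r : ℝ => r ^ (n - 1) * ∫ θ, H (r • θ.1)
      ∂(volume : Measure (EuclideanSpace ℝ (Fin n))).toSphere) (Set.Ioi 0) ∧
    ∫ x, H x = ∫ r in Set.Ioi (0 : ℝ), r ^ (n - 1) * ∫ θ, H (r • θ.1)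
      ∂(volume : Measure (EuclideanSpace ℝ (Fin n))).toSphere := by
  have : Nonempty (Fin n) := ⟨⟨0, hn⟩⟩
  set μ : Measure (EuclideanSpace ℝ (Fin n)) := volume
  have hmp := μ.measurePreserving_homeomorphUnitSphereProd
  rw [finrank_euclideanSpace_fin] at hmp
  have hemb := (homeomorphUnitSphereProd (EuclideanSpace ℝ (Fin n))).measurableEmbedding
  set g : Metric.sphere (0 : EuclideanSpace ℝ (Fin n)) 1 × Set.Ioi (0 : ℝ) → ℝ :=
    fun p => H (p.2.1 • p.1.1) with hg
  have hcomp : (fun x : ({0}ᶜ : Set (EuclideanSpace ℝ (Fin n))) =>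
      g (homeomorphUnitSphereProd _ x)) = fun x => H x.1 := by
    funext x
    have hx : ‖(x : EuclideanSpace ℝ (Fin n))‖ ≠ 0 := norm_ne_zero_iff.2 x.2
    simp [hg, smul_smul, hx]
  have hs0 : MeasurableSet ({0}ᶜ : Set (EuclideanSpace ℝ (Fin n))) :=
    (measurableSet_singleton _).compl
  have hgi : Integrable g (μ.toSphere.prod (Measure.volumeIoiPow (n - 1))) := by
    rw [← hmp.integrable_comp_emb hemb]
    change Integrable (fun x => g (homeomorphUnitSphereProd _ x)) _
    rw [hcomp]
    exact (integrableOn_iff_comap_subtypeVal hs0).1 hH.integrableOn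
  have hint : ∫ x, H x = ∫ p, g p ∂(μ.toSphere.prod (Measure.volumeIoiPow (n - 1))) := by
    rw [← hmp.integral_comp hemb, hcomp, integral_subtype_comap hs0 fun x => H x,
      restrict_compl_singleton]
  have hden : Measurable fun r : Set.Ioi (0 : ℝ) => (r.1 ^ (n - 1)).toNNReal := by fun_prop
  have hI := hgi.integral_prod_right
  simp only [Measure.volumeIoiPow, ENNReal.ofReal] at hI
  rw [integrable_withDensity_iff_integrable_smul hden] at hI
  have hcg : ∀ r : Set.Ioi (0 : ℝ), (r.1 ^ (n - 1)).toNNReal • (∫ θ, g (θ, r) ∂μ.toSphere) =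
      r.1 ^ (n - 1) * ∫ θ, H (r.1 • θ.1) ∂μ.toSphere := by
    intro r
    rw [NNReal.smul_def, Real.coe_toNNReal _ (pow_nonneg r.2.out.le _), smul_eq_mul]
  simp_rw [hcg] at hI
  refine ⟨(integrableOn_iff_comap_subtypeVal measurableSet_Ioi).2 hI, ?_⟩
  rw [hint, integral_prod_symm _ hgi]
  simp only [Measure.volumeIoiPow, ENNReal.ofReal]
  rw [integral_withDensity_eq_integral_smul hden]
  simp_rw [hcg]
  exact integral_subtype_comap measurableSet_Ioi
    fun r : ℝ => r ^ (n - 1) * ∫ θ, H (r • θ.1) ∂μ.toSphere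

/-- The surface measure of the sphere of radius `a` in `ℝⁿ`, and `0` if `a ≤ 0`. -/
noncomputable def sphereMeasure (n : ℕ) (a : ℝ) : Measure (EuclideanSpace ℝ (Fin n)) :=
  if 0 < a then
    ENNReal.ofReal (a ^ (n - 1)) •
      (volume : Measure (EuclideanSpace ℝ (Fin n))).toSphere.map (fun θ => a • θ.1)
  else 0

instance (n : ℕ) (a : ℝ) : IsFiniteMeasure (sphereMeasure n a) := by
  unfold sphereMeasure
  split_ifs
  · exact Measure.smul_finite _ ENNReal.ofReal_ne_top
  · infer_instance

theorem integral_sphereMeasure {n : ℕ} {a : ℝ} (ha : 0 < a) {F : EuclideanSpace ℝ (Fin n) → ℝ}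
    (hF : Continuous F) :
    ∫ x, F x ∂(sphereMeasure n a) = a ^ (n - 1) * ∫ θ, F (a • θ.1)
      ∂(volume : Measure (EuclideanSpace ℝ (Fin n))).toSphere := by
  rw [sphereMeasure, if_pos ha, integral_smul_measure,
    integral_map (by fun_prop) hF.aestronglyMeasurable,
    ENNReal.toReal_ofReal (pow_nonneg ha.le _), smul_eq_mul]

theorem isMicrocanonical_sphereMeasure {n : ℕ} (hn : 1 ≤ n) :
    IsMicrocanonical (Phi n) (sphereMeasure n) := by
  have key : ∀ (F : EuclideanSpace ℝ (Fin n) → ℝ) (G : ℝ → ℝ), Continuous F →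
      HasCompactSupport F → Continuous G →
      (fun a => G a * ∫ x, F x ∂(sphereMeasure n a)) =
        (Set.Ioi (0 : ℝ)).indicator fun r : ℝ => r ^ (n - 1) *
          ∫ θ, (fun x : EuclideanSpace ℝ (Fin n) => G ‖x‖ * F x) (r • θ.1)
            ∂(volume : Measure (EuclideanSpace ℝ (Fin n))).toSphere := by
    intro F G hF _ _
    funext a
    by_cases ha : 0 < a
    · rw [Set.indicator_of_mem (Set.mem_Ioi.2 ha), integral_sphereMeasure ha hF]
      have : ∀ θ : Metric.sphere (0 : EuclideanSpace ℝ (Fin n)) 1, ‖a • θ.1‖ = a := by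
        intro θ
        rw [norm_smul, norm_eq_of_mem_sphere θ, mul_one, Real.norm_of_nonneg ha.le]
      simp only [this]
      rw [integral_const_mul]
      ring
    · rw [Set.indicator_of_notMem (by simpa using ha), sphereMeasure, if_neg ha]
      simp
  have hint : ∀ (F : EuclideanSpace ℝ (Fin n) → ℝ) (G : ℝ → ℝ), Continuous F →
      HasCompactSupport F → Continuous G → Integrable (fun x => G ‖x‖ * F x) :=
    fun F G hF hc hG => Continuous.integrable_of_hasCompactSupport (by fun_prop) hc.mul_left
  refine ⟨ae_of_all _ fun a => inferInstance, fun F G hF hc hG => ?_, fun F G hF hc hG => ?_⟩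
  · rw [key F G hF hc hG, integrable_indicator_iff measurableSet_Ioi]
    exact (integral_polar hn (hint F G hF hc hG)).1
  · rw [key F G hF hc hG, integral_indicator measurableSet_Ioi]
    exact (integral_polar hn (hint F G hF hc hG)).2.symm

theorem isMicrocanonicalAt_sphereMeasure {n : ℕ} (hn : 1 ≤ n) {y : ℝ} (hy : 0 < y) :
    IsMicrocanonicalAt (Phi n) y (sphereMeasure n y) := by
  refine ⟨inferInstance, fun φ hφ hc => ?_⟩
  set Ψ : ℝ → ℝ := fun r => r ^ (n - 1) * ∫ θ, φ (r • θ.1)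
    ∂(volume : Measure (EuclideanSpace ℝ (Fin n))).toSphere with hΨ
  obtain ⟨C, hC⟩ := hc.exists_bound_of_continuous hφ
  have hΨc : Continuous Ψ := by
    refine (continuous_pow _).mul ?_
    exact continuous_of_dominated (fun r => by fun_prop)
      (fun r => ae_of_all _ fun θ => hC _) (integrable_const C)
      (ae_of_all _ fun θ => by fun_prop)
  have hshell : ∀ h : ℝ, 0 < h →
      ∫ x in {x | y ≤ Phi n x ∧ Phi n x < y + h}, φ x = ∫ r in y..(y + h), Ψ r := by
    intro h hh
    have hm : MeasurableSet {x : EuclideanSpace ℝ (Fin n) | y ≤ Phi n x ∧ Phi n x < y + h} :=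
      (measurableSet_le measurable_const measurable_norm).inter
        (measurableSet_lt measurable_norm measurable_const)
    rw [← integral_indicator hm,
      (integral_polar hn ((hφ.integrable_of_hasCompactSupport hc).indicator hm)).2,
      intervalIntegral.integral_of_le (by linarith), ← integral_Ico_eq_integral_Ioc,
      ← integral_indicator measurableSet_Ioi, ← integral_indicator measurableSet_Ico]
    congr 1
    funext r
    by_cases hr : 0 < r
    · rw [Set.indicator_of_mem (Set.mem_Ioi.2 hr)]
      have hnorm : ∀ θ : Metric.sphere (0 : EuclideanSpace ℝ (Fin n)) 1, Phi n (r • θ.1) = r := by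
        intro θ
        rw [Phi, norm_smul, norm_eq_of_mem_sphere θ, mul_one, Real.norm_of_nonneg hr.le]
      simp only [Set.indicator, Set.mem_ofPred_eq, hnorm, Set.mem_Ico]
      split_ifs <;> simp [hΨ]
    · rw [Set.indicator_of_notMem (by simpa using hr),
        Set.indicator_of_notMem fun h' => hr (hy.trans_le h'.1)]
  -- The shell averages are the right difference quotients of a primitive of `Ψ` at `y`.
  have hd := intervalIntegral.integral_hasDerivAt_right (hΨc.intervalIntegrable y y)
    hΨc.aestronglyMeasurable.stronglyMeasurableAtFilter hΨc.continuousAt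
  rw [hasDerivAt_iff_tendsto_slope_zero] at hd
  have hd' := hd.mono_left (nhdsWithin_mono (0 : ℝ) (fun t (ht : 0 < t) => ht.ne'))
  rw [integral_sphereMeasure hy hφ]
  refine hd'.congr' ?_
  filter_upwards [self_mem_nhdsWithin] with h hh
  rw [hshell h hh, intervalIntegral.integral_same, sub_zero, smul_eq_mul]

/-- The radial cut-off profile, equal to `1` on `(-∞, R]` and to `0` on `[R + 1, ∞)`. -/
noncomputable def cutoff (R : ℕ) (r : ℝ) : ℝ := max 0 (min 1 (R + 1 - r))

theorem continuous_cutoff (R : ℕ) : Continuous (cutoff R) := by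
  unfold cutoff
  fun_prop

theorem cutoff_eq_one {R : ℕ} {r : ℝ} (h : r ≤ R) : cutoff R r = 1 := by
  rw [cutoff, min_eq_left (by linarith), max_eq_right zero_le_one]

theorem cutoff_nonneg (R : ℕ) (r : ℝ) : 0 ≤ cutoff R r := le_max_left _ _

theorem hasCompactSupport_cutoff_norm (n R : ℕ) :
    HasCompactSupport fun x : EuclideanSpace ℝ (Fin n) => cutoff R ‖x‖ := by
  refine HasCompactSupport.intro (isCompact_closedBall (0 : EuclideanSpace ℝ (Fin n)) (R + 1))
    fun x hx => ?_
  rw [mem_closedBall_zero_iff, not_le] at hx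
  rw [cutoff, max_eq_left]
  exact (min_le_right _ _).trans (by linarith)

theorem monotone_cutoff (r : ℝ) : Monotone fun R : ℕ => cutoff R r := by
  intro R R' h
  have : (R : ℝ) ≤ R' := by exact_mod_cast h
  exact max_le_max le_rfl (min_le_min le_rfl (by linarith))

/-- The total mass of a locally finite measure, from its integrals against the cut-offs. -/
theorem measure_univ_of_integral_cutoff {n : ℕ} {m : Measure (EuclideanSpace ℝ (Fin n))}
    [IsLocallyFiniteMeasure m] {M : ℝ}
    (h : ∀ᶠ R : ℕ in atTop, ∫ x, cutoff R ‖x‖ ∂m = M) : m Set.univ = ENNReal.ofReal M := by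
  have hcont : ∀ R, Continuous fun x : EuclideanSpace ℝ (Fin n) => cutoff R ‖x‖ :=
    fun R => (continuous_cutoff R).comp continuous_norm
  have h1 : Tendsto (fun R : ℕ => ∫⁻ x, ENNReal.ofReal (cutoff R ‖x‖) ∂m) atTop
      (𝓝 (∫⁻ _, 1 ∂m)) := by
    refine lintegral_tendsto_of_tendsto_of_monotone
      (fun R => (ENNReal.measurable_ofReal.comp (hcont R).measurable).aemeasurable)
      (ae_of_all _ fun x R R' hR => ENNReal.ofReal_le_ofReal (monotone_cutoff _ hR))
      (ae_of_all _ fun x => ?_)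
    refine tendsto_const_nhds.congr' ?_
    filter_upwards [eventually_ge_atTop ⌈‖x‖⌉₊] with R hR
    rw [cutoff_eq_one (Nat.ceil_le.1 hR), ENNReal.ofReal_one]
  rw [lintegral_one] at h1
  refine tendsto_nhds_unique h1 (tendsto_const_nhds.congr' ?_)
  filter_upwards [h] with R hR
  rw [← hR, ofReal_integral_eq_lintegral_ofReal
    ((hcont R).integrable_of_hasCompactSupport (hasCompactSupport_cutoff_norm n R))
    (ae_of_all _ fun x => cutoff_nonneg _ _)]

/-- The surface area of the unit sphere in `ℝⁿ`. -/
noncomputable def sphereArea (n : ℕ) : ℝ :=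
  n * (volume : Measure (EuclideanSpace ℝ (Fin n))).real (Metric.ball 0 1)

theorem volume_real_ball_pos (n : ℕ) :
    0 < (volume : Measure (EuclideanSpace ℝ (Fin n))).real (Metric.ball 0 1) :=
  ENNReal.toReal_pos (Metric.measure_ball_pos _ _ one_pos).ne' measure_ball_lt_top.ne

theorem sphereArea_pos {n : ℕ} (hn : 1 ≤ n) : 0 < sphereArea n :=
  mul_pos (by exact_mod_cast hn) (volume_real_ball_pos n)

theorem integral_comp_norm {n : ℕ} (hn : 1 ≤ n) (f : ℝ → ℝ) :
    ∫ x : EuclideanSpace ℝ (Fin n), f ‖x‖ =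
      ∫ r in Set.Ioi (0 : ℝ), sphereArea n * r ^ (n - 1) * f r := by
  have : Nonempty (Fin n) := ⟨⟨0, hn⟩⟩
  have h := integral_fun_norm_addHaar (volume : Measure (EuclideanSpace ℝ (Fin n))) f
  rw [finrank_euclideanSpace_fin] at h
  rw [h, nsmul_eq_mul, smul_eq_mul, ← mul_assoc, ← integral_const_mul]
  simp only [smul_eq_mul, sphereArea, mul_assoc]

/-- Almost every member of a disintegration of Lebesgue measure along the norm has the mass of the
corresponding sphere: testing against a radial cut-off identifies the integral of the cut-off
as a function of the level. -/
theorem microcanonical_univ {n : ℕ} (hn : 1 ≤ n) {δ : ℝ → Measure (EuclideanSpace ℝ (Fin n))}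
    (h : IsMicrocanonical (Phi n) δ) :
    ∀ᵐ y ∂(volume.restrict (Set.Ioi (0 : ℝ))),
      δ y Set.univ = ENNReal.ofReal (sphereArea n * y ^ (n - 1)) := by
  have hcont : ∀ R, Continuous fun x : EuclideanSpace ℝ (Fin n) => cutoff R ‖x‖ :=
    fun R => (continuous_cutoff R).comp continuous_norm
  have h1 : ∀ R : ℕ, (fun a => ∫ x, cutoff R ‖x‖ ∂(δ a)) =ᵐ[volume]
      (Set.Ioi (0 : ℝ)).indicator fun r => sphereArea n * r ^ (n - 1) * cutoff R r := by
    intro R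
    have hi1 := h.integrable _ (fun _ => 1) (hcont R) (hasCompactSupport_cutoff_norm n R)
      continuous_const
    simp only [one_mul] at hi1
    have hi2 : Integrable
        ((Set.Ioi (0 : ℝ)).indicator fun r => sphereArea n * r ^ (n - 1) * cutoff R r) := by
      rw [integrable_indicator_iff measurableSet_Ioi]
      have h2 := (integral_polar hn ((hcont R).integrable_of_hasCompactSupport
        (hasCompactSupport_cutoff_norm n R))).1
      refine h2.congr_fun (fun r hr => ?_) measurableSet_Ioi
      have hr0 : (0 : ℝ) < r := hr
      simp only [norm_smul, norm_eq_of_mem_sphere, mul_one, Real.norm_of_nonneg hr0.le,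
        integral_const, smul_eq_mul, Measure.toSphere_real_apply_univ, finrank_euclideanSpace_fin,
        sphereArea]
      ring
    refine ae_eq_of_integral_contDiff_smul_eq hi1.locallyIntegrable hi2.locallyIntegrable
      fun g hg _ => ?_
    simp only [smul_eq_mul]
    rw [h.integral_eq _ g (hcont R) (hasCompactSupport_cutoff_norm n R) hg.continuous]
    simp only [Phi]
    rw [integral_comp_norm hn fun r => g r * cutoff R r, ← integral_indicator measurableSet_Ioi]
    congr 1
    funext r
    by_cases hr : 0 < r
    · simp only [Set.indicator_of_mem (Set.mem_Ioi.2 hr)]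
      ring
    · simp only [Set.indicator_of_notMem (show r ∉ Set.Ioi (0 : ℝ) by simpa using hr), mul_zero]
  filter_upwards [ae_restrict_of_ae (ae_all_iff.2 h1), ae_restrict_of_ae h.locallyFinite,
    ae_restrict_mem measurableSet_Ioi] with y hy hlf hy0
  refine measure_univ_of_integral_cutoff ?_
  filter_upwards [eventually_ge_atTop ⌈y⌉₊] with R hR
  rw [hy R, Set.indicator_of_mem hy0, cutoff_eq_one (Nat.ceil_le.1 hR), mul_one]

theorem microcanonicalAt_univ {n : ℕ} (hn : 1 ≤ n) {y : ℝ} (hy : 0 < y)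
    {m : Measure (EuclideanSpace ℝ (Fin n))} (h : IsMicrocanonicalAt (Phi n) y m) :
    m Set.univ = ENNReal.ofReal (sphereArea n * y ^ (n - 1)) := by
  have := h.locallyFinite
  have hcont : ∀ R, Continuous fun x : EuclideanSpace ℝ (Fin n) => cutoff R ‖x‖ :=
    fun R => (continuous_cutoff R).comp continuous_norm
  refine measure_univ_of_integral_cutoff ?_
  filter_upwards [eventually_ge_atTop ⌈y⌉₊] with R hR
  rw [tendsto_nhds_unique (h.tendsto _ (hcont R) (hasCompactSupport_cutoff_norm n R))
    ((isMicrocanonicalAt_sphereMeasure hn hy).tendsto _ (hcont R)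
      (hasCompactSupport_cutoff_norm n R)), integral_sphereMeasure hy (hcont R)]
  simp only [norm_smul, norm_eq_of_mem_sphere, mul_one, Real.norm_of_nonneg hy.le,
    cutoff_eq_one (Nat.ceil_le.1 hR), integral_const, smul_eq_mul,
    Measure.toSphere_real_apply_univ, finrank_euclideanSpace_fin, sphereArea]
  ring

theorem exp_S {n : ℕ} (hn : 1 ≤ n) {y : ℝ} (hy : 0 < y) : Real.exp (S n y) = y ^ (n - 1) := by
  rw [S, ← Nat.cast_one, ← Nat.cast_sub hn, Real.exp_nat_mul, Real.exp_log hy]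

theorem S_eq_log_add {n : ℕ} (hn : 1 ≤ n) {A y : ℝ} (hA : 0 < A) (hy : 0 < y) :
    (S n y : EReal) =
      ENNReal.log (ENNReal.ofReal (A * y ^ (n - 1))) + ((-Real.log A : ℝ) : EReal) := by
  rw [ENNReal.log_ofReal_of_pos (mul_pos hA (pow_pos hy _)),
    Real.log_mul hA.ne' (pow_pos hy _).ne', ← exp_S hn hy, Real.log_exp, ← EReal.coe_add]
  congr 1
  ring

instance isProbabilityMeasure_mu (n : ℕ) : IsProbabilityMeasure (mu n) := by
  refine ⟨?_⟩
  rw [mu, Measure.smul_apply, Measure.restrict_apply_univ, smul_eq_mul]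
  exact ENNReal.inv_mul_cancel (Metric.measure_ball_pos _ _ one_pos).ne' measure_ball_lt_top.ne

theorem measurable_Phi (n : ℕ) : Measurable (Phi n) := measurable_norm

instance isProbabilityMeasure_nu (n : ℕ) : IsProbabilityMeasure (nu n) :=
  Measure.isProbabilityMeasure_map (measurable_Phi n).aemeasurable

theorem integral_nu {n : ℕ} (hn : 1 ≤ n) {f : ℝ → ℝ} (hf : Measurable f) :
    ∫ y, f y ∂(nu n) = ∫ y in Set.Ioo (0 : ℝ) 1, n * y ^ (n - 1) * f y := by
  have hv := (volume_real_ball_pos n).ne'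
  have h1 : ∀ x : EuclideanSpace ℝ (Fin n),
      (Metric.ball (0 : EuclideanSpace ℝ (Fin n)) 1).indicator (fun x => f ‖x‖) x =
      (Set.Iio (1 : ℝ)).indicator f ‖x‖ := by
    intro x
    simp [Set.indicator]
  rw [nu, integral_map (measurable_Phi n).aemeasurable hf.aestronglyMeasurable, mu,
    integral_smul_measure, ← integral_indicator measurableSet_ball]
  simp only [Phi, h1]
  rw [integral_comp_norm hn, smul_eq_mul, ENNReal.toReal_inv, ← integral_const_mul,
    ← integral_indicator measurableSet_Ioi, ← integral_indicator measurableSet_Ioo]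
  congr 1
  funext r
  simp only [Set.indicator, Set.mem_Ioi, Set.mem_Iio, Set.mem_Ioo]
  by_cases h0 : 0 < r <;> by_cases h2 : r < 1 <;>
    simp only [h0, h2, if_true, if_false, mul_zero, and_self, and_true, and_false, sphereArea]
  rw [Measure.real] at hv ⊢
  field_simp

theorem nu_eq_withDensity {n : ℕ} (hn : 1 ≤ n) :
    nu n = (volume.restrict (Set.Ioo (0 : ℝ) 1)).withDensity
      (fun y => ENNReal.ofReal (n * y ^ (n - 1))) := by
  have hi : IntegrableOn (fun y : ℝ => n * y ^ (n - 1)) (Set.Ioo 0 1) :=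
    (Continuous.integrableOn_Icc (by fun_prop)).mono_set Set.Ioo_subset_Icc_self
  have : IsFiniteMeasure ((volume.restrict (Set.Ioo (0 : ℝ) 1)).withDensity
      (fun y => ENNReal.ofReal (n * y ^ (n - 1)))) :=
    isFiniteMeasure_withDensity_ofReal hi.2
  refine ext_of_forall_integral_eq_of_IsFiniteMeasure fun f => ?_
  rw [integral_nu hn f.continuous.measurable]
  simp only [ENNReal.ofReal]
  rw [integral_withDensity_eq_integral_smul (by fun_prop)]
  refine setIntegral_congr_fun measurableSet_Ioo fun y hy => ?_
  rw [NNReal.smul_def, Real.coe_toNNReal _ (mul_nonneg n.cast_nonneg (pow_nonneg hy.1.le _)),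
    smul_eq_mul]

theorem integral_even_pow_nu {n : ℕ} (hn : 1 ≤ n) (k : ℕ) :
    ∫ y, (y ^ 2) ^ k ∂(nu n) = n / (n + 2 * k) := by
  rw [integral_nu hn (by fun_prop), ← integral_Ioc_eq_integral_Ioo,
    ← intervalIntegral.integral_of_le zero_le_one]
  have : ∀ y : ℝ, n * y ^ (n - 1) * (y ^ 2) ^ k = n * y ^ (n - 1 + 2 * k) := by
    intro y
    rw [← pow_mul, mul_assoc, ← pow_add]
  simp_rw [this]
  rw [intervalIntegral.integral_const_mul, integral_pow]
  have h2 : ((n - 1 + 2 * k : ℕ) : ℝ) + 1 = n + 2 * k := by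
    push_cast [Nat.cast_sub hn]
    ring
  rw [h2]
  simp [div_eq_mul_inv]

theorem nu_ae_mem_Icc {n : ℕ} (hn : 1 ≤ n) : ∀ᵐ y ∂(nu n), y ∈ Set.Icc (0 : ℝ) 1 := by
  rw [nu_eq_withDensity hn]
  refine (withDensity_absolutelyContinuous _ _).ae_le ?_
  filter_upwards [ae_restrict_mem measurableSet_Ioo] with y hy using ⟨hy.1.le, hy.2.le⟩

theorem rnDeriv_nu {n : ℕ} (hn : 1 ≤ n) :
    ∀ᵐ y ∂(volume.restrict (Set.Ioo (0 : ℝ) 1)),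
      (nu n).rnDeriv volume y = ENNReal.ofReal (n * y ^ (n - 1)) := by
  have hm : Measurable fun y : ℝ => ENNReal.ofReal (n * y ^ (n - 1)) := by fun_prop
  have h := Measure.rnDeriv_withDensity (volume : Measure ℝ)
    (hm.indicator (measurableSet_Ioo (a := (0 : ℝ)) (b := 1)))
  rw [withDensity_indicator measurableSet_Ioo, ← nu_eq_withDensity hn] at h
  filter_upwards [ae_restrict_of_ae h, ae_restrict_mem measurableSet_Ioo] with y hy hy1
  rw [hy, Set.indicator_of_mem hy1]

/-! ### Orthogonal increments and Gaussian moments -/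

section Increments

variable {Ω : Type*} {mΩ : MeasurableSpace Ω} {P : Measure Ω}

/-- Vitali's theorem for a sequence bounded in `L²`. -/
theorem tendsto_integral_of_sq_bounded [IsProbabilityMeasure P] {Z : ℕ → Ω → ℝ} {Z' : Ω → ℝ} {K : ℝ}
    (hm : ∀ N, MemLp (Z N) 2 P) (hK : ∀ N, ∫ ω, Z N ω ^ 2 ∂P ≤ K)
    (h : ∀ᵐ ω ∂P, Tendsto (fun N => Z N ω) atTop (𝓝 (Z' ω))) :
    Integrable Z' P ∧ Tendsto (fun N => ∫ ω, Z N ω ∂P) atTop (𝓝 (∫ ω, Z' ω ∂P)) := by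
  have hK0 : 0 ≤ K := (integral_nonneg fun ω => sq_nonneg _).trans (hK 0)
  have hi : ∀ N, Integrable (Z N) P := fun N => (hm N).integrable one_le_two
  have hUI : UniformIntegrable Z 1 P := by
    refine uniformIntegrable_of le_rfl ENNReal.one_ne_top (fun N => (hm N).1) fun ε hε => ?_
    have hC : (0 : ℝ) < (K + 1) / ε := by positivity
    refine ⟨((K + 1) / ε).toNNReal, fun N => ?_⟩
    set A : Set Ω := {x | ((K + 1) / ε).toNNReal ≤ ‖Z N x‖₊}
    have hpt : ∀ ω, ‖A.indicator (Z N) ω‖ₑ ≤ ENNReal.ofReal (ε / (K + 1) * Z N ω ^ 2) := by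
      intro ω
      by_cases hω : ω ∈ A
      · rw [Set.indicator_of_mem hω, ← ofReal_norm]
        refine ENNReal.ofReal_le_ofReal ?_
        have h1 : (K + 1) / ε ≤ |Z N ω| := by
          have := Real.toNNReal_le_iff_le_coe.1 hω
          simpa using this
        rw [div_le_iff₀ hε] at h1
        rw [Real.norm_eq_abs, ← sq_abs, div_mul_eq_mul_div, le_div_iff₀ (by positivity)]
        nlinarith [abs_nonneg (Z N ω)]
      · rw [Set.indicator_of_notMem hω]
        simp
    rw [eLpNorm_one_eq_lintegral_enorm]
    refine (lintegral_mono hpt).trans ?_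
    rw [← ofReal_integral_eq_lintegral_ofReal ((hm N).integrable_sq.const_mul _)
      (ae_of_all _ fun ω => by positivity), integral_const_mul]
    refine ENNReal.ofReal_le_ofReal ?_
    rw [div_mul_eq_mul_div, div_le_iff₀ (by positivity)]
    nlinarith [hK N]
  have hZ' : Integrable Z' P := hUI.integrable_of_ae_tendsto h
  refine ⟨hZ', ?_⟩
  refine tendsto_integral_of_L1' Z' hZ'.aestronglyMeasurable (Eventually.of_forall hi) ?_
  exact tendsto_Lp_finite_of_tendsto_ae le_rfl ENNReal.one_ne_top (fun N => (hm N).1)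
    (memLp_one_iff_integrable.2 hZ') hUI.unifIntegrable h

theorem exists_subseq_tendsto_zero_of_integral_sq {Z : ℕ → Ω → ℝ}
    (hm : ∀ N, MemLp (Z N) 2 P) (h : Tendsto (fun N => ∫ ω, Z N ω ^ 2 ∂P) atTop (𝓝 0)) :
    ∃ ns : ℕ → ℕ, StrictMono ns ∧
      ∀ᵐ ω ∂P, Tendsto (fun j => Z (ns j) ω) atTop (𝓝 0) := by
  have h1 : TendstoInMeasure P (fun N ω => Z N ω ^ 2) atTop (fun _ => (0 : ℝ)) := by
    refine tendstoInMeasure_of_tendsto_eLpNorm one_ne_zero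
      (fun N => (hm N).integrable_sq.aestronglyMeasurable) aestronglyMeasurable_const ?_
    have h2 : ∀ N, eLpNorm ((fun ω => Z N ω ^ 2) - fun _ => (0 : ℝ)) 1 P =
        ENNReal.ofReal (∫ ω, Z N ω ^ 2 ∂P) := by
      intro N
      rw [eLpNorm_one_eq_lintegral_enorm, ofReal_integral_eq_lintegral_ofReal
        (hm N).integrable_sq (ae_of_all _ fun ω => sq_nonneg _)]
      refine lintegral_congr fun ω => ?_
      simp [← ofReal_norm]
    simp_rw [h2]
    simpa using ENNReal.tendsto_ofReal h
  obtain ⟨ns, hns, hae⟩ := h1.exists_seq_tendsto_ae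
  refine ⟨ns, hns, hae.mono fun ω hω => ?_⟩
  have := hω.sqrt
  simp only [Real.sqrt_sq_eq_abs, Real.sqrt_zero] at this
  exact (tendsto_zero_iff_abs_tendsto_zero _).2 this

/-- Sums of predictable multiples of centred innovations are centred, and their second moment grows
at most linearly in the number of terms, since different terms are orthogonal. -/
theorem predictable_sum [IsProbabilityMeasure P] {ι : Type*} [Fintype ι] {F : ℕ → MeasurableSpace Ω}
    (hmono : Monotone F) (hF : ∀ i, F i ≤ mΩ) {α ζ : ℕ → ι → Ω → ℝ} {C v : ℝ}
    (hα : ∀ i j, Measurable[F i] (α i j)) (hαC : ∀ i j, ∀ᵐ ω ∂P, |α i j ω| ≤ C)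
    (hζ : ∀ i j, Measurable[F (i + 1)] (ζ i j))
    (hind : ∀ i j, Indep (MeasurableSpace.comap (ζ i j) inferInstance) (F i) P)
    (hL : ∀ i j, MemLp (ζ i j) 2 P) (hmean : ∀ i j, ∫ ω, ζ i j ω ∂P = 0)
    (hv : ∀ i j, ∫ ω, ζ i j ω ^ 2 ∂P ≤ v) (N : ℕ) :
    MemLp (fun ω => ∑ i ∈ Finset.range N, ∑ j, α i j ω * ζ i j ω) 2 P ∧
    ∫ ω, ∑ i ∈ Finset.range N, ∑ j, α i j ω * ζ i j ω ∂P = 0 ∧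
    ∫ ω, (∑ i ∈ Finset.range N, ∑ j, α i j ω * ζ i j ω) ^ 2 ∂P ≤
      N * ((Fintype.card ι : ℝ) ^ 2 * C ^ 2 * v) := by
  have hα' : ∀ i j, Measurable (α i j) := fun i j => (hα i j).mono (hF i) le_rfl
  have hterm : ∀ i j, MemLp (fun ω => α i j ω * ζ i j ω) 2 P := by
    intro i j
    have hb := MemLp.of_bound (hα' i j).aestronglyMeasurable (p := ∞) C (hαC i j)
    exact (hL i j).mul' hb
  set D : ℕ → Ω → ℝ := fun i ω => ∑ j, α i j ω * ζ i j ω with hD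
  have hDL : ∀ i, MemLp (D i) 2 P := fun i => memLp_finsetSum _ fun j _ => hterm i j
  have hDm : ∀ i, Measurable[F (i + 1)] (D i) := fun i =>
    Finset.measurable_sum _ fun j _ => ((hα i j).mono (hmono i.le_succ) le_rfl).mul (hζ i j)
  have horth1 : ∀ i j (S : Ω → ℝ), Measurable[F i] S → MemLp S 2 P →
      ∫ ω, S ω * (α i j ω * ζ i j ω) ∂P = 0 := by
    intro i j S hS hS2
    have hI : IndepFun (fun ω => S ω * α i j ω) (ζ i j) P := by
      rw [IndepFun_iff_Indep]
      exact indep_of_indep_of_le_left (hind i j).symm (hS.mul (hα i j)).comap_le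
    have := hI.integral_fun_mul_eq_mul_integral
      ((hS.mono (hF i) le_rfl).mul (hα' i j)).aestronglyMeasurable (hL i j).1
    rw [hmean, mul_zero] at this
    rw [← this]
    refine integral_congr_ae (ae_of_all _ fun ω => ?_)
    simp only
    ring
  have horth : ∀ i (S : Ω → ℝ), Measurable[F i] S → MemLp S 2 P → ∫ ω, S ω * D i ω ∂P = 0 := by
    intro i S hS hS2
    simp only [hD, Finset.mul_sum]
    have hi : ∀ j ∈ Finset.univ, Integrable (fun ω => S ω * (α i j ω * ζ i j ω)) P :=
      fun j _ => hS2.integrable_mul (hterm i j)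
    rw [integral_finsetSum _ hi]
    exact Finset.sum_eq_zero fun j _ => horth1 i j S hS hS2
  have hsq : ∀ i, ∫ ω, D i ω ^ 2 ∂P ≤ (Fintype.card ι : ℝ) ^ 2 * C ^ 2 * v := by
    intro i
    have h1 : ∀ᵐ ω ∂P, D i ω ^ 2 ≤ (Fintype.card ι : ℝ) * ∑ j, C ^ 2 * ζ i j ω ^ 2 := by
      filter_upwards [ae_all_iff.2 (hαC i)] with ω hω
      refine (sq_sum_le_card_mul_sum_sq).trans ?_
      refine mul_le_mul_of_nonneg_left (Finset.sum_le_sum fun j _ => ?_) (Nat.cast_nonneg _)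
      rw [mul_pow]
      refine mul_le_mul_of_nonneg_right ?_ (sq_nonneg _)
      exact sq_le_sq' (by linarith [(abs_le.1 (hω j)).1]) (abs_le.1 (hω j)).2
    have hii : ∀ j ∈ Finset.univ, Integrable (fun ω => C ^ 2 * ζ i j ω ^ 2) P :=
      fun j _ => (hL i j).integrable_sq.const_mul _
    refine (integral_mono_ae (hDL i).integrable_sq
      ((integrable_finsetSum _ hii).const_mul _) h1).trans ?_
    rw [integral_const_mul, integral_finsetSum _ hii]
    have h2 : ∑ j : ι, ∫ ω, C ^ 2 * ζ i j ω ^ 2 ∂P ≤ ∑ _j : ι, C ^ 2 * v := by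
      refine Finset.sum_le_sum fun j _ => ?_
      rw [integral_const_mul]
      exact mul_le_mul_of_nonneg_left (hv i j) (sq_nonneg _)
    refine (mul_le_mul_of_nonneg_left h2 (Nat.cast_nonneg _)).trans_eq ?_
    rw [Finset.sum_const, Finset.card_univ, nsmul_eq_mul]
    ring
  have hSL : ∀ N, MemLp (fun ω => ∑ i ∈ Finset.range N, D i ω) 2 P :=
    fun N => memLp_finsetSum _ fun i _ => hDL i
  have hSm : ∀ N, Measurable[F N] (fun ω => ∑ i ∈ Finset.range N, D i ω) := fun N =>
    Finset.measurable_sum _ fun i hi =>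
      (hDm i).mono (hmono (Nat.succ_le_of_lt (Finset.mem_range.1 hi))) le_rfl
  refine ⟨hSL N, ?_, ?_⟩
  · change ∫ ω, ∑ i ∈ Finset.range N, D i ω ∂P = 0
    rw [integral_finsetSum _ fun i _ => (hDL i).integrable one_le_two]
    refine Finset.sum_eq_zero fun i _ => ?_
    simpa using horth i (fun _ => 1) measurable_const (memLp_const 1)
  · change ∫ ω, (∑ i ∈ Finset.range N, D i ω) ^ 2 ∂P ≤ _
    induction N with
    | zero => simp
    | succ N ih =>
      have e : ∀ ω, (∑ i ∈ Finset.range (N + 1), D i ω) ^ 2 =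
          (∑ i ∈ Finset.range N, D i ω) ^ 2 +
            2 * ((∑ i ∈ Finset.range N, D i ω) * D N ω) + D N ω ^ 2 := by
        intro ω
        rw [Finset.sum_range_succ]
        ring
      simp_rw [e]
      have i1 := (hSL N).integrable_sq
      have i2 := ((hSL N).integrable_mul (hDL N)).const_mul 2
      have i3 := (hDL N).integrable_sq
      simp only [Pi.mul_apply] at i2
      have i12 : Integrable (fun ω => (∑ i ∈ Finset.range N, D i ω) ^ 2 +
          2 * ((∑ i ∈ Finset.range N, D i ω) * D N ω)) P := i1.add i2
      rw [integral_add i12 i3, integral_add i1 i2, integral_const_mul,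
        horth N _ (hSm N) (hSL N)]
      push_cast
      linarith [hsq N]

/-- The fourth moment of the standard Gaussian distribution. -/
noncomputable def gaussianFourthMoment : ℝ := ∫ x, x ^ 4 ∂(gaussianReal 0 1)

theorem integral_pow_four_gaussianReal (v : ℝ≥0) :
    ∫ x, x ^ 4 ∂(gaussianReal 0 v) = gaussianFourthMoment * (v : ℝ) ^ 2 := by
  have h := gaussianReal_map_const_mul (μ := 0) (v := 1) (√(v : ℝ))
  have hv : NNReal.mk (√(v : ℝ) ^ 2) (sq_nonneg _) * 1 = v := by
    ext
    simp
  rw [hv, mul_zero] at h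
  rw [← h, integral_map (by fun_prop) (by fun_prop), gaussianFourthMoment, ← integral_mul_const]
  refine integral_congr_ae (ae_of_all _ fun x => ?_)
  have : √(v : ℝ) ^ 4 = (v : ℝ) ^ 2 := by
    rw [show (4 : ℕ) = 2 * 2 from rfl, pow_mul, Real.sq_sqrt v.coe_nonneg]
  simp only
  rw [mul_pow, this, mul_comm]

section Brownian

variable {n : ℕ} {𝓕 : Filtration ℝ≥0 mΩ} {W : ℝ≥0 → Ω → EuclideanSpace ℝ (Fin n)}

theorem IsBrownian.hasLaw_increment (hW : IsBrownian P 𝓕 W) {s t : ℝ≥0} (hst : s ≤ t) (a : Fin n) :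
    HasLaw (fun ω => W t ω a - W s ω a) (gaussianReal 0 (t - s)) P := by
  have h := (hW.coord a).hasLaw_sub t s
  have e : nndist (t : ℝ) (s : ℝ) = t - s := by
    ext
    rw [coe_nndist, Real.dist_eq, NNReal.coe_sub hst,
      abs_of_nonneg (sub_nonneg.2 (by exact_mod_cast hst))]
  have e' : nndist t.1 s.1 = t - s := e
  rw [e'] at h
  exact h

theorem IsBrownian.memLp_increment (hW : IsBrownian P 𝓕 W) {s t : ℝ≥0} (hst : s ≤ t) (a : Fin n)
    (p : ℝ≥0) : MemLp (fun ω => W t ω a - W s ω a) p P := by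
  have h := hW.hasLaw_increment hst a
  have := memLp_id_gaussianReal (μ := 0) (v := t - s) p
  rw [← h.map_eq] at this
  exact this.comp_of_map h.aemeasurable

theorem IsBrownian.integral_increment (hW : IsBrownian P 𝓕 W) {s t : ℝ≥0} (hst : s ≤ t)
    (a : Fin n) : ∫ ω, (W t ω a - W s ω a) ∂P = 0 := by
  rw [(hW.hasLaw_increment hst a).integral_eq]
  exact integral_id_gaussianReal

theorem IsBrownian.integral_increment_sq (hW : IsBrownian P 𝓕 W) {s t : ℝ≥0} (hst : s ≤ t)
    (a : Fin n) : ∫ ω, (W t ω a - W s ω a) ^ 2 ∂P = t - s := by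
  have h := hW.hasLaw_increment hst a
  have := h.integral_comp (f := fun x : ℝ => x ^ 2) (by fun_prop)
  have e : ∫ x, x ^ 2 ∂(gaussianReal 0 (t - s)) = ((t - s : ℝ≥0) : ℝ) := by
    have h1 := variance_fun_id_gaussianReal (μ := 0) (v := t - s)
    rw [variance_eq_integral (by fun_prop)] at h1
    simpa [integral_id_gaussianReal] using h1
  rw [e, NNReal.coe_sub hst] at this
  exact this

theorem IsBrownian.integral_increment_pow_four (hW : IsBrownian P 𝓕 W) {s t : ℝ≥0} (hst : s ≤ t)
    (a : Fin n) : ∫ ω, (W t ω a - W s ω a) ^ 4 ∂P = gaussianFourthMoment * (t - s : ℝ) ^ 2 := by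
  have h := hW.hasLaw_increment hst a
  have := h.integral_comp (f := fun x : ℝ => x ^ 4) (by fun_prop)
  rw [integral_pow_four_gaussianReal, NNReal.coe_sub hst] at this
  exact this

theorem IsBrownian.integral_increment_mul (hW : IsBrownian P 𝓕 W) {s t : ℝ≥0} (hst : s ≤ t)
    (a b : Fin n) : ∫ ω, (W t ω a - W s ω a) * (W t ω b - W s ω b) ∂P =
      if a = b then (t - s : ℝ) else 0 := by
  split_ifs with hab
  · subst hab
    simp_rw [← sq]
    exact hW.integral_increment_sq hst a
  · have h1 := (hW.indep_coord.indepFun hab).comp (φ := fun f : ℝ≥0 → ℝ => f t - f s)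
      (ψ := fun f : ℝ≥0 → ℝ => f t - f s) (by fun_prop) (by fun_prop)
    have h2 := h1.integral_fun_mul_eq_mul_integral (hW.memLp_increment hst a 1).1
      (hW.memLp_increment hst b 1).1
    simp only [Function.comp_apply] at h2
    rw [h2, hW.integral_increment hst, zero_mul]

theorem IsBrownian.memLp_increment_mul (hW : IsBrownian P 𝓕 W) {s t : ℝ≥0} (hst : s ≤ t)
    (a b : Fin n) : MemLp (fun ω => (W t ω a - W s ω a) * (W t ω b - W s ω b)) 2 P := by
  have : ENNReal.HolderTriple ((4 : ℝ≥0) : ℝ≥0∞) ((4 : ℝ≥0) : ℝ≥0∞) 2 := by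
    refine ⟨?_⟩
    push_cast
    rw [← ENNReal.toReal_eq_toReal_iff' (by simp) (by simp), ENNReal.toReal_add (by simp) (by simp)]
    norm_num
  exact (hW.memLp_increment hst b 4).mul' (hW.memLp_increment hst a 4)

theorem IsBrownian.integral_increment_mul_sq_le (hW : IsBrownian P 𝓕 W) {s t : ℝ≥0} (hst : s ≤ t)
    (a b : Fin n) : ∫ ω, ((W t ω a - W s ω a) * (W t ω b - W s ω b)) ^ 2 ∂P ≤
      gaussianFourthMoment * (t - s : ℝ) ^ 2 := by
  have h4 : ∀ a, Integrable (fun ω => (W t ω a - W s ω a) ^ 4) P := by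
    intro a
    have := (hW.memLp_increment_mul hst a a).integrable_sq
    refine this.congr (ae_of_all _ fun ω => ?_)
    simp only
    ring
  have h1 : ∫ ω, ((W t ω a - W s ω a) * (W t ω b - W s ω b)) ^ 2 ∂P ≤
      ∫ ω, ((1 / 2) * (W t ω a - W s ω a) ^ 4 + (1 / 2) * (W t ω b - W s ω b) ^ 4) ∂P := by
    refine integral_mono (hW.memLp_increment_mul hst a b).integrable_sq
      (((h4 a).const_mul _).add ((h4 b).const_mul _)) fun ω => ?_
    simp only
    nlinarith [sq_nonneg ((W t ω a - W s ω a) ^ 2 - (W t ω b - W s ω b) ^ 2)]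
  refine h1.trans_eq ?_
  rw [integral_add ((h4 a).const_mul _) ((h4 b).const_mul _), integral_const_mul,
    integral_const_mul, hW.integral_increment_pow_four hst, hW.integral_increment_pow_four hst]
  ring

end Brownian

end Increments

/-! ### Pathwise Taylor expansions along partitions -/

/-- `p₁` and `p₂` are the first two derivatives of `p₀` on `[0, 1]`, in the sense that the second
order Taylor formula holds with a cubic remainder. One constant `C` bounds the remainder and both
derivatives. -/
structure TaylorOnUnit (p₀ p₁ p₂ : ℝ → ℝ) (C : ℝ) : Prop where
  continuous₁ : Continuous p₁
  continuous₂ : Continuous p₂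
  remainder : ∀ s ∈ Set.Icc (0 : ℝ) 1, ∀ s' ∈ Set.Icc (0 : ℝ) 1,
    |p₀ s' - p₀ s - p₁ s * (s' - s) - p₂ s / 2 * (s' - s) ^ 2| ≤ C * |s' - s| ^ 3
  abs_le₁ : ∀ s ∈ Set.Icc (0 : ℝ) 1, |p₁ s| ≤ C
  abs_le₂ : ∀ s ∈ Set.Icc (0 : ℝ) 1, |p₂ s| ≤ C

theorem exists_pow_remainder_bound (k : ℕ) : ∃ C : ℝ, 0 ≤ C ∧ ∀ s ∈ Set.Icc (0 : ℝ) 1,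
    ∀ s' ∈ Set.Icc (0 : ℝ) 1,
    |s' ^ (k + 1) - s ^ (k + 1) - (k + 1) * s ^ k * (s' - s) -
      (k + 1) * k * s ^ (k - 1) / 2 * (s' - s) ^ 2| ≤ C * |s' - s| ^ 3 := by
  induction k with
  | zero =>
    refine ⟨0, le_rfl, fun s _ s' _ => ?_⟩
    simp
  | succ k ih =>
    obtain ⟨C, hC, h⟩ := ih
    refine ⟨C + (k + 1) * k / 2, by positivity, fun s hs s' hs' => ?_⟩
    have h1 := h s hs s' hs'
    have hs1 : (k : ℝ) * s ^ k = k * (s * s ^ (k - 1)) := by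
      rcases k with _ | k
      · simp
      · rw [Nat.add_sub_cancel, pow_succ]
        ring
    have e : s' ^ (k + 1 + 1) - s ^ (k + 1 + 1) - ((k + 1 : ℕ) + 1 : ℝ) * s ^ (k + 1) * (s' - s) -
        ((k + 1 : ℕ) + 1 : ℝ) * (k + 1 : ℕ) * s ^ (k + 1 - 1) / 2 * (s' - s) ^ 2 =
        s' * (s' ^ (k + 1) - s ^ (k + 1) - (k + 1) * s ^ k * (s' - s) -
          (k + 1) * k * s ^ (k - 1) / 2 * (s' - s) ^ 2) +
        (k + 1) * k / 2 * s ^ (k - 1) * (s' - s) ^ 3 := by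
      rw [Nat.add_sub_cancel]
      push_cast
      linear_combination ((k : ℝ) + 1) * (-1 / 2) * (s' - s) ^ 2 * hs1
    rw [e]
    refine (abs_add_le _ _).trans ?_
    rw [abs_mul, abs_of_nonneg hs'.1, abs_mul _ ((s' - s) ^ 3), abs_pow, add_mul C]
    refine add_le_add ?_ ?_
    · exact (mul_le_of_le_one_left (abs_nonneg _) hs'.2).trans h1
    · refine mul_le_mul_of_nonneg_right ?_ (by positivity)
      have : s ^ (k - 1) ≤ 1 := pow_le_one₀ hs.1 hs.2
      have h0 : 0 ≤ s ^ (k - 1) := pow_nonneg hs.1 _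
      rw [abs_of_nonneg (by positivity)]
      exact mul_le_of_le_one_right (by positivity) this

theorem exists_taylorOnUnit_pow (k : ℕ) : ∃ C : ℝ, 0 ≤ C ∧
    TaylorOnUnit (fun s => s ^ (k + 1)) (fun s => (k + 1) * s ^ k)
      (fun s => (k + 1) * k * s ^ (k - 1)) C := by
  obtain ⟨C, hC, h⟩ := exists_pow_remainder_bound k
  refine ⟨C + (k + 1) + (k + 1) * k, by positivity, by fun_prop, by fun_prop,
    fun s hs s' hs' => (h s hs s' hs').trans ?_, fun s hs => ?_, fun s hs => ?_⟩
  · refine mul_le_mul_of_nonneg_right ?_ (by positivity)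
    have : (0 : ℝ) ≤ (k + 1) * k := by positivity
    linarith [(k.cast_nonneg : (0 : ℝ) ≤ k)]
  · have h1 : s ^ k ≤ 1 := pow_le_one₀ hs.1 hs.2
    have h0 : 0 ≤ s ^ k := pow_nonneg hs.1 _
    rw [abs_of_nonneg (by positivity)]
    have := mul_le_of_le_one_right (by positivity : (0 : ℝ) ≤ k + 1) h1
    have : (0 : ℝ) ≤ (k + 1) * k := by positivity
    linarith
  · have h1 : s ^ (k - 1) ≤ 1 := pow_le_one₀ hs.1 hs.2
    have h0 : 0 ≤ s ^ (k - 1) := pow_nonneg hs.1 _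
    rw [abs_of_nonneg (by positivity)]
    have := mul_le_of_le_one_right (by positivity : (0 : ℝ) ≤ (k + 1) * k) h1
    linarith [(k.cast_nonneg : (0 : ℝ) ≤ k)]

theorem taylorOnUnit_id : TaylorOnUnit (fun s => s) (fun _ => 1) (fun _ => 0) 1 := by
  refine ⟨by fun_prop, by fun_prop, fun s _ s' _ => ?_, by simp, by simp⟩
  simp

section Step

variable {E : Type*} [NormedAddCommGroup E] [InnerProductSpace ℝ E]

local notation "⟪" x ", " y "⟫" => inner ℝ x y

/-- Second order expansion of `p₀ (‖x‖ ^ 2)` along a step `σ ξ - A`, in which only the terms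
of first order in `A` are kept. -/
theorem taylor_step {p₀ p₁ p₂ : ℝ → ℝ} {C σ : ℝ} (hC : 0 ≤ C) (hσ : 0 ≤ σ)
    (hp : TaylorOnUnit p₀ p₁ p₂ C) {x x' ξ A : E} (hx : ‖x‖ ≤ 1) (hx' : ‖x'‖ ≤ 1)
    (hstep : x' - x = σ • ξ - A) :
    |p₀ (‖x'‖ ^ 2) - p₀ (‖x‖ ^ 2) - 2 * σ * (p₁ (‖x‖ ^ 2) * ⟪x, ξ⟫) +
      2 * (p₁ (‖x‖ ^ 2) * ⟪x, A⟫) -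
      σ ^ 2 * (p₁ (‖x‖ ^ 2) * ‖ξ‖ ^ 2 + 2 * p₂ (‖x‖ ^ 2) * ⟪x, ξ⟫ ^ 2)| ≤
    10 * C * ‖x' - x‖ ^ 3 + 3 * C * (2 * σ * (‖ξ‖ * ‖A‖) + ‖A‖ ^ 2) := by
  set h := x' - x with hh
  have hsx : ‖x‖ ^ 2 ∈ Set.Icc (0 : ℝ) 1 := ⟨sq_nonneg _, pow_le_one₀ (norm_nonneg _) hx⟩
  have hsx' : ‖x'‖ ^ 2 ∈ Set.Icc (0 : ℝ) 1 := ⟨sq_nonneg _, pow_le_one₀ (norm_nonneg _) hx'⟩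
  have hd : ‖x'‖ ^ 2 - ‖x‖ ^ 2 = 2 * ⟪x, h⟫ + ‖h‖ ^ 2 := by
    have : x' = x + h := by rw [hh]; abel
    rw [this, norm_add_sq_real]
    ring
  have hdle : |‖x'‖ ^ 2 - ‖x‖ ^ 2| ≤ 2 * ‖h‖ := by
    rw [sq_sub_sq, abs_mul, abs_of_nonneg (by positivity)]
    exact mul_le_mul (by linarith) (abs_norm_sub_norm_le _ _) (abs_nonneg _) (by norm_num)
  have hxh : |⟪x, h⟫| ≤ ‖h‖ := (abs_real_inner_le_norm _ _).trans
    (mul_le_of_le_one_left (norm_nonneg _) hx)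
  have hxξ : |⟪x, ξ⟫| ≤ ‖ξ‖ := (abs_real_inner_le_norm _ _).trans
    (mul_le_of_le_one_left (norm_nonneg _) hx)
  have hxA : |⟪x, A⟫| ≤ ‖A‖ := (abs_real_inner_le_norm _ _).trans
    (mul_le_of_le_one_left (norm_nonneg _) hx)
  have h1 := hp.abs_le₁ _ hsx
  have h2 := hp.abs_le₂ _ hsx
  have hT := hp.remainder _ hsx _ hsx'
  set s := ‖x‖ ^ 2
  set s' := ‖x'‖ ^ 2
  have hT' : C * |s' - s| ^ 3 ≤ 8 * C * ‖h‖ ^ 3 := by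
    have := pow_le_pow_left₀ (abs_nonneg _) hdle 3
    nlinarith
  have hQ : |p₂ s / 2 * (‖h‖ ^ 2 * (2 * ⟪x, h⟫ + (s' - s)))| ≤ 2 * C * ‖h‖ ^ 3 := by
    rw [abs_mul, abs_mul, abs_div, abs_of_nonneg (sq_nonneg ‖h‖), abs_two]
    have h3 : |2 * ⟪x, h⟫ + (s' - s)| ≤ 4 * ‖h‖ := by
      refine (abs_add_le _ _).trans ?_
      rw [abs_mul, abs_two]
      linarith
    calc |p₂ s| / 2 * (‖h‖ ^ 2 * |2 * ⟪x, h⟫ + (s' - s)|)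
        ≤ C / 2 * (‖h‖ ^ 2 * (4 * ‖h‖)) := by gcongr
      _ = 2 * C * ‖h‖ ^ 3 := by ring
  have hinner : ⟪x, h⟫ = σ * ⟪x, ξ⟫ - ⟪x, A⟫ := by
    rw [hstep, inner_sub_right, real_inner_smul_right]
  have hnorm : ‖h‖ ^ 2 = σ ^ 2 * ‖ξ‖ ^ 2 - 2 * σ * ⟪ξ, A⟫ + ‖A‖ ^ 2 := by
    rw [hstep, norm_sub_sq_real, norm_smul, real_inner_smul_left, Real.norm_of_nonneg hσ]
    ring
  have hξA := abs_real_inner_le_norm ξ A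
  have hR1 : |p₁ s * (-(2 * σ * ⟪ξ, A⟫) + ‖A‖ ^ 2)| ≤ C * (2 * σ * (‖ξ‖ * ‖A‖) + ‖A‖ ^ 2) := by
    rw [abs_mul]
    refine mul_le_mul h1 ((abs_add_le _ _).trans ?_) (abs_nonneg _) hC
    rw [abs_neg, abs_mul, abs_of_nonneg (by positivity : 0 ≤ 2 * σ), abs_of_nonneg (sq_nonneg ‖A‖)]
    gcongr
  have hR2 : |2 * p₂ s * (-(2 * σ * (⟪x, ξ⟫ * ⟪x, A⟫)) + ⟪x, A⟫ ^ 2)| ≤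
      2 * C * (2 * σ * (‖ξ‖ * ‖A‖) + ‖A‖ ^ 2) := by
    rw [abs_mul, abs_mul, abs_two]
    refine mul_le_mul (by linarith) ((abs_add_le _ _).trans ?_) (abs_nonneg _) (by linarith)
    rw [abs_neg, abs_mul, abs_of_nonneg (by positivity : 0 ≤ 2 * σ), abs_mul,
      abs_of_nonneg (sq_nonneg ⟪x, A⟫), ← sq_abs ⟪x, A⟫]
    gcongr
  have key : p₀ s' - p₀ s - 2 * σ * (p₁ s * ⟪x, ξ⟫) + 2 * (p₁ s * ⟪x, A⟫) -
      σ ^ 2 * (p₁ s * ‖ξ‖ ^ 2 + 2 * p₂ s * ⟪x, ξ⟫ ^ 2) =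
      (p₀ s' - p₀ s - p₁ s * (s' - s) - p₂ s / 2 * (s' - s) ^ 2) +
      p₂ s / 2 * (‖h‖ ^ 2 * (2 * ⟪x, h⟫ + (s' - s))) +
      p₁ s * (-(2 * σ * ⟪ξ, A⟫) + ‖A‖ ^ 2) +
      2 * p₂ s * (-(2 * σ * (⟪x, ξ⟫ * ⟪x, A⟫)) + ⟪x, A⟫ ^ 2) := by
    rw [hd, hinner, hnorm]
    ring
  rw [key]
  refine (abs_add_le _ _).trans ?_
  have a1 := abs_add_le ((p₀ s' - p₀ s - p₁ s * (s' - s) - p₂ s / 2 * (s' - s) ^ 2) +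
      p₂ s / 2 * (‖h‖ ^ 2 * (2 * ⟪x, h⟫ + (s' - s)))) (p₁ s * (-(2 * σ * ⟪ξ, A⟫) + ‖A‖ ^ 2))
  have a2 := abs_add_le (p₀ s' - p₀ s - p₁ s * (s' - s) - p₂ s / 2 * (s' - s) ^ 2)
      (p₂ s / 2 * (‖h‖ ^ 2 * (2 * ⟪x, h⟫ + (s' - s))))
  linarith

/-- The expansion of `taylor_step` summed along a chain of `M` short steps. -/
theorem taylor_sum {p₀ p₁ p₂ : ℝ → ℝ} {C σ ε : ℝ} (hC : 0 ≤ C) (hσ : 0 ≤ σ)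
    (hp : TaylorOnUnit p₀ p₁ p₂ C) {x ξ A : ℕ → E} {M : ℕ} (hx : ∀ i, ‖x i‖ ≤ 1)
    (hstep : ∀ i < M, x (i + 1) - x i = σ • ξ i - A i) (hε : 0 ≤ ε) (hε1 : ε ≤ 1)
    (hxε : ∀ i < M, ‖x (i + 1) - x i‖ ≤ ε) (hξε : ∀ i < M, ‖ξ i‖ ≤ ε) (hAε : ∀ i < M, ‖A i‖ ≤ ε) :
    |p₀ (‖x M‖ ^ 2) - p₀ (‖x 0‖ ^ 2) -
      2 * σ * (∑ i ∈ Finset.range M, p₁ (‖x i‖ ^ 2) * ⟪x i, ξ i⟫) +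
      2 * (∑ i ∈ Finset.range M, p₁ (‖x i‖ ^ 2) * ⟪x i, A i⟫) -
      σ ^ 2 * (∑ i ∈ Finset.range M,
        (p₁ (‖x i‖ ^ 2) * ‖ξ i‖ ^ 2 + 2 * p₂ (‖x i‖ ^ 2) * ⟪x i, ξ i⟫ ^ 2))| ≤
    ε * ((20 * C * σ ^ 2) * (∑ i ∈ Finset.range M, ‖ξ i‖ ^ 2) +
      (23 * C + 6 * C * σ) * (∑ i ∈ Finset.range M, ‖A i‖)) := by
  have htel : p₀ (‖x M‖ ^ 2) - p₀ (‖x 0‖ ^ 2) =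
      ∑ i ∈ Finset.range M, (p₀ (‖x (i + 1)‖ ^ 2) - p₀ (‖x i‖ ^ 2)) :=
    (Finset.sum_range_sub (fun i => p₀ (‖x i‖ ^ 2)) M).symm
  rw [htel, Finset.mul_sum, Finset.mul_sum, Finset.mul_sum, Finset.mul_sum, Finset.mul_sum,
    ← Finset.sum_sub_distrib, ← Finset.sum_add_distrib, ← Finset.sum_sub_distrib,
    ← Finset.sum_add_distrib, Finset.mul_sum]
  refine (Finset.abs_sum_le_sum_abs _ _).trans (Finset.sum_le_sum fun i hi => ?_)
  have hi := Finset.mem_range.1 hi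
  refine (taylor_step hC hσ hp (hx i) (hx (i + 1)) (hstep i hi)).trans ?_
  have hA := hAε i hi
  have hξ := hξε i hi
  have hA0 := norm_nonneg (A i)
  have hξ0 := norm_nonneg (ξ i)
  have hhsq : ‖x (i + 1) - x i‖ ^ 2 ≤ 2 * (σ ^ 2 * ‖ξ i‖ ^ 2) + 2 * ‖A i‖ := by
    have h1 : ‖x (i + 1) - x i‖ ≤ σ * ‖ξ i‖ + ‖A i‖ := by
      rw [hstep i hi]
      refine (norm_sub_le _ _).trans_eq ?_
      rw [norm_smul, Real.norm_of_nonneg hσ]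
    have h2 := pow_le_pow_left₀ (norm_nonneg _) h1 2
    nlinarith [sq_nonneg (σ * ‖ξ i‖ - ‖A i‖)]
  have hcube : ‖x (i + 1) - x i‖ ^ 3 ≤ ε * (2 * (σ ^ 2 * ‖ξ i‖ ^ 2) + 2 * ‖A i‖) := by
    rw [pow_succ']
    exact mul_le_mul (hxε i hi) hhsq (sq_nonneg _) hε
  have hξA : ‖ξ i‖ * ‖A i‖ ≤ ε * ‖A i‖ := mul_le_mul_of_nonneg_right hξ hA0
  have hAA : ‖A i‖ ^ 2 ≤ ε * ‖A i‖ := by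
    rw [sq]
    exact mul_le_mul_of_nonneg_right hA hA0
  calc 10 * C * ‖x (i + 1) - x i‖ ^ 3 + 3 * C * (2 * σ * (‖ξ i‖ * ‖A i‖) + ‖A i‖ ^ 2)
      ≤ 10 * C * (ε * (2 * (σ ^ 2 * ‖ξ i‖ ^ 2) + 2 * ‖A i‖)) +
        3 * C * (2 * σ * (ε * ‖A i‖) + ε * ‖A i‖) := by gcongr
    _ = ε * (20 * C * σ ^ 2 * ‖ξ i‖ ^ 2 + (23 * C + 6 * C * σ) * ‖A i‖) := by ring

end Step

/-- The `i`-th point of the uniform partition of `[0, t]` into `N + 1` intervals. -/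
noncomputable def gridPoint (t : ℝ≥0) (N i : ℕ) : ℝ≥0 := t * i / (N + 1)

theorem gridPoint_zero (t : ℝ≥0) (N : ℕ) : gridPoint t N 0 = 0 := by simp [gridPoint]

theorem gridPoint_last (t : ℝ≥0) (N : ℕ) : gridPoint t N (N + 1) = t := by
  rw [gridPoint]
  push_cast
  field_simp

theorem monotone_gridPoint (t : ℝ≥0) (N : ℕ) : Monotone (gridPoint t N) := by
  intro i j hij
  unfold gridPoint
  gcongr

theorem gridPoint_succ_sub (t : ℝ≥0) (N i : ℕ) :
    (gridPoint t N (i + 1) : ℝ) - gridPoint t N i = t / (N + 1) := by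
  simp only [gridPoint]
  push_cast
  ring

theorem gridPoint_le (t : ℝ≥0) {N i : ℕ} (hi : i ≤ N + 1) : gridPoint t N i ≤ t :=
  (monotone_gridPoint t N hi).trans_eq (gridPoint_last t N)

theorem eventually_grid_oscillation {E : Type*} [PseudoMetricSpace E] {f : ℝ≥0 → E}
    (hf : Continuous f) (t : ℝ≥0) {ε : ℝ} (hε : 0 < ε) :
    ∀ᶠ N in atTop, ∀ i < N + 1, ∀ s ∈ Set.Icc (gridPoint t N i) (gridPoint t N (i + 1)),
      dist (f s) (f (gridPoint t N i)) ≤ ε := by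
  have hu := isCompact_Icc.uniformContinuousOn_of_continuous
    (hf.continuousOn (s := Set.Icc 0 t))
  rw [Metric.uniformContinuousOn_iff] at hu
  obtain ⟨η, hη, h⟩ := hu ε hε
  have hlim : Tendsto (fun N : ℕ => (t : ℝ) / (N + 1)) atTop (𝓝 0) :=
    tendsto_const_nhds.div_atTop (tendsto_natCast_atTop_atTop.atTop_add tendsto_const_nhds)
  filter_upwards [hlim.eventually_lt_const hη] with N hN i hi s hs
  refine (h s ⟨zero_le, hs.2.trans (gridPoint_le t hi)⟩ _
    ⟨zero_le, gridPoint_le t (by omega)⟩ ?_).le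
  have h1 := gridPoint_succ_sub t N i
  have h2 : (gridPoint t N i : ℝ) ≤ s := hs.1
  have h3 : (s : ℝ) ≤ gridPoint t N (i + 1) := hs.2
  rw [NNReal.dist_eq, abs_of_nonneg (by linarith)]
  linarith

theorem sum_setIntegral_grid {E : Type*} [NormedAddCommGroup E] [NormedSpace ℝ E]
    {μ : Measure ℝ≥0} {t : ℝ≥0} {g : ℝ≥0 → E} (hg : IntegrableOn g (Set.Iic t) μ) (N : ℕ)
    {M : ℕ} (hM : M ≤ N + 1) :
    ∑ i ∈ Finset.range M, ∫ s in Set.Ioc (gridPoint t N i) (gridPoint t N (i + 1)), g s ∂μ =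
      ∫ s in Set.Ioc 0 (gridPoint t N M), g s ∂μ := by
  induction M with
  | zero => simp [gridPoint_zero]
  | succ M ih =>
    rw [Finset.sum_range_succ, ih (by omega),
      ← Set.Ioc_union_Ioc_eq_Ioc zero_le (monotone_gridPoint t N M.le_succ),
      setIntegral_union (Set.Ioc_disjoint_Ioc_of_le le_rfl) measurableSet_Ioc]
    · exact hg.mono_set
        (Set.Ioc_subset_Iic_self.trans (Set.Iic_subset_Iic.2 (gridPoint_le t (by omega))))
    · exact hg.mono_set (Set.Ioc_subset_Iic_self.trans (Set.Iic_subset_Iic.2 (gridPoint_le t hM)))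

theorem tendsto_riemann_sum {φ : ℝ≥0 → ℝ} (hφ : Continuous φ) (t : ℝ≥0) :
    Tendsto (fun N : ℕ => ∑ i ∈ Finset.range (N + 1), (t / (N + 1) : ℝ) * φ (gridPoint t N i)) atTop
      (𝓝 (∫ s in (0 : ℝ)..t, φ s.toNNReal)) := by
  rw [Metric.tendsto_atTop']
  intro ε hε
  have hη : 0 < ε / (t + 1) := by positivity
  obtain ⟨N₀, hN₀⟩ := eventually_atTop.1 (eventually_grid_oscillation hφ t hη)
  refine ⟨N₀, fun N hN => ?_⟩
  have hc : Continuous fun s : ℝ => φ s.toNNReal := hφ.comp continuous_real_toNNReal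
  have hsum := intervalIntegral.sum_integral_adjacent_intervals (μ := volume)
    (f := fun s : ℝ => φ s.toNNReal) (a := fun i => (gridPoint t N i : ℝ)) (n := N + 1)
    fun k _ => hc.intervalIntegrable _ _
  rw [gridPoint_zero, gridPoint_last, NNReal.coe_zero] at hsum
  rw [← hsum, dist_eq_norm, ← Finset.sum_sub_distrib]
  have hle : ∀ i, (gridPoint t N i : ℝ) ≤ gridPoint t N (i + 1) :=
    fun i => monotone_gridPoint t N i.le_succ
  calc ‖∑ i ∈ Finset.range (N + 1), ((t / (N + 1) : ℝ) * φ (gridPoint t N i) -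
        ∫ s in (gridPoint t N i : ℝ)..gridPoint t N (i + 1), φ s.toNNReal)‖
      ≤ ∑ i ∈ Finset.range (N + 1), ε / (t + 1) * (t / (N + 1)) := by
        refine (norm_sum_le _ _).trans (Finset.sum_le_sum fun i hi => ?_)
        have hi := Finset.mem_range.1 hi
        rw [← gridPoint_succ_sub t N i, ← smul_eq_mul, ← intervalIntegral.integral_const,
          ← intervalIntegral.integral_sub (by simp) (hc.intervalIntegrable _ _)]
        refine (intervalIntegral.norm_integral_le_of_norm_le_const
          (C := ε / (t + 1)) fun s hs => ?_).trans_eq ?_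
        · rw [Set.uIoc_of_le (hle i)] at hs
          have := hN₀ N hN.le i hi s.toNNReal
            ⟨NNReal.le_toNNReal_of_coe_le hs.1.le, Real.toNNReal_le_iff_le_coe.2 hs.2⟩
          rwa [dist_comm, dist_eq_norm] at this
        · rw [abs_of_nonneg (sub_nonneg.2 (hle i))]
    _ = ε * (t / (t + 1)) := by
        rw [Finset.sum_const, Finset.card_range, nsmul_eq_mul]
        push_cast
        field_simp
    _ < ε := by
        refine mul_lt_of_lt_one_right hε ?_
        rw [div_lt_one (by positivity)]
        linarith

section Stieltjes

variable {E : Type*} [NormedAddCommGroup E] [InnerProductSpace ℝ E] [FiniteDimensional ℝ E]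

local notation "⟪" x ", " y "⟫" => inner ℝ x y

theorem integrableOn_Iic_of_norm_le_one {μ : Measure ℝ≥0} {t : ℝ≥0} (hμ : μ (Set.Iic t) < ∞)
    {X : ℝ≥0 → E} (hX : Continuous X) (hX1 : ∀ s, ‖X s‖ ≤ 1) : IntegrableOn X (Set.Iic t) μ := by
  have : IsFiniteMeasure (μ.restrict (Set.Iic t)) := ⟨by rwa [Measure.restrict_apply_univ]⟩
  exact Integrable.of_bound hX.aestronglyMeasurable 1 (ae_of_all _ hX1)

theorem sum_norm_setIntegral_grid_le {μ : Measure ℝ≥0} {t : ℝ≥0} (hμ : μ (Set.Iic t) < ∞)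
    {X : ℝ≥0 → E} (hX : Continuous X) (hX1 : ∀ s, ‖X s‖ ≤ 1) (N : ℕ) :
    ∑ i ∈ Finset.range (N + 1),
      ‖∫ s in Set.Ioc (gridPoint t N i) (gridPoint t N (i + 1)), X s ∂μ‖ ≤ μ.real (Set.Iic t) := by
  have hi := integrableOn_Iic_of_norm_le_one hμ hX hX1
  have : IsFiniteMeasure (μ.restrict (Set.Iic t)) := ⟨by rwa [Measure.restrict_apply_univ]⟩
  calc _ ≤ ∑ i ∈ Finset.range (N + 1),
        ∫ s in Set.Ioc (gridPoint t N i) (gridPoint t N (i + 1)), ‖X s‖ ∂μ :=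
        Finset.sum_le_sum fun i _ => norm_integral_le_integral_norm _
    _ = ∫ s in Set.Ioc 0 t, ‖X s‖ ∂μ := by
        rw [sum_setIntegral_grid hi.norm N le_rfl, gridPoint_last]
    _ ≤ ∫ s in Set.Iic t, ‖X s‖ ∂μ :=
        setIntegral_mono_set hi.norm (ae_of_all _ fun s => norm_nonneg _)
          (Set.Ioc_subset_Iic_self.eventuallyLE)
    _ ≤ ∫ _ in Set.Iic t, (1 : ℝ) ∂μ := integral_mono hi.norm (integrable_const _) hX1
    _ = μ.real (Set.Iic t) := by simp

/-- Convergence of Riemann-Stieltjes sums for an integrator of the form `X dμ`. -/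
theorem tendsto_stieltjes_sum {μ : Measure ℝ≥0} {t : ℝ≥0} (hμ : μ (Set.Iic t) < ∞)
    (hμ0 : μ {0} = 0) {X v : ℝ≥0 → E} (hX : Continuous X) (hX1 : ∀ s, ‖X s‖ ≤ 1)
    (hv : Continuous v) :
    Tendsto (fun N : ℕ => ∑ i ∈ Finset.range (N + 1), ⟪v (gridPoint t N i),
        ∫ s in Set.Ioc (gridPoint t N i) (gridPoint t N (i + 1)), X s ∂μ⟫) atTop
      (𝓝 (∫ s in Set.Iic t, ⟪v s, X s⟫ ∂μ)) := by
  have hfin : IsFiniteMeasure (μ.restrict (Set.Iic t)) := ⟨by rwa [Measure.restrict_apply_univ]⟩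
  have hXi := integrableOn_Iic_of_norm_le_one hμ hX hX1
  have hvX : IntegrableOn (fun s => ⟪v s, X s⟫) (Set.Iic t) μ := by
    obtain ⟨B, hB⟩ := (isCompact_Icc (a := (0 : ℝ≥0)) (b := t)).exists_bound_of_continuousOn
      hv.continuousOn
    refine Integrable.of_bound (by fun_prop) B ?_
    filter_upwards [ae_restrict_mem measurableSet_Iic] with s hs
    refine (norm_inner_le_norm _ _).trans ?_
    exact (mul_le_of_le_one_right (norm_nonneg _) (hX1 s)).trans (hB s ⟨zero_le, hs⟩)
  have hIoc : ∫ s in Set.Iic t, ⟪v s, X s⟫ ∂μ = ∫ s in Set.Ioc 0 t, ⟪v s, X s⟫ ∂μ := by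
    refine setIntegral_congr_set ?_
    have h0 : ∀ᵐ s ∂μ, s ≠ 0 := by
      rw [ae_iff]
      simpa using hμ0
    filter_upwards [h0] with s hs
    exact propext ⟨fun h => ⟨pos_iff_ne_zero.2 hs, h⟩, fun h => h.2⟩
  rw [Metric.tendsto_atTop']
  intro ε hε
  set Λ := μ.real (Set.Iic t)
  have hη : 0 < ε / (Λ + 1) := by positivity
  obtain ⟨N₀, hN₀⟩ := eventually_atTop.1 (eventually_grid_oscillation hv t hη)
  refine ⟨N₀, fun N hN => ?_⟩
  have hsub : ∀ i < N + 1, Set.Ioc (gridPoint t N i) (gridPoint t N (i + 1)) ⊆ Set.Iic t :=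
    fun i hi => Set.Ioc_subset_Iic_self.trans (Set.Iic_subset_Iic.2 (gridPoint_le t hi))
  have hsum := sum_setIntegral_grid hvX N le_rfl
  rw [gridPoint_last] at hsum
  rw [hIoc, ← hsum, dist_eq_norm, ← Finset.sum_sub_distrib]
  calc _ ≤ ∑ i ∈ Finset.range (N + 1),
        ∫ _ in Set.Ioc (gridPoint t N i) (gridPoint t N (i + 1)), ε / (Λ + 1) ∂μ := by
        refine (norm_sum_le _ _).trans (Finset.sum_le_sum fun i hi => ?_)
        have hi := Finset.mem_range.1 hi
        have hXi' := hXi.mono_set (hsub i hi)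
        have hvX' := hvX.mono_set (hsub i hi)
        have : IsFiniteMeasure (μ.restrict (Set.Ioc (gridPoint t N i) (gridPoint t N (i + 1)))) :=
          ⟨by
            rw [Measure.restrict_apply_univ]
            exact (measure_mono (hsub i hi)).trans_lt hμ⟩
        rw [← integral_inner hXi', ← integral_sub (hXi'.const_inner _) hvX']
        refine norm_integral_le_of_norm_le (integrable_const _) ?_
        filter_upwards [ae_restrict_mem measurableSet_Ioc] with s hs
        rw [← inner_sub_left]
        refine (norm_inner_le_norm _ _).trans ?_
        refine (mul_le_of_le_one_right (norm_nonneg _) (hX1 s)).trans ?_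
        rw [← dist_eq_norm, dist_comm]
        exact hN₀ N hN.le i hi s ⟨hs.1.le, hs.2⟩
    _ = ∫ _ in Set.Ioc 0 t, ε / (Λ + 1) ∂μ := by
        rw [sum_setIntegral_grid (integrable_const _) N le_rfl, gridPoint_last]
    _ ≤ ∫ _ in Set.Iic t, ε / (Λ + 1) ∂μ :=
        setIntegral_mono_set (integrable_const _) (ae_of_all _ fun _ => hη.le)
          (Set.Ioc_subset_Iic_self.eventuallyLE)
    _ = ε * (Λ / (Λ + 1)) := by
        rw [setIntegral_const, smul_eq_mul]
        ring
    _ < ε := by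
        refine mul_lt_of_lt_one_right hε ?_
        rw [div_lt_one (by positivity)]
        linarith

/-- Pathwise limit behind Itô's formula for `p₀ (‖X‖ ^ 2)`: along any sequence of partitions for
which the quadratic variation of the driving path converges (in the weighted sense `hQ` and with
bounded total `hV`), the stochastic part of the Taylor expansion converges, and its limit is the
increment of `p₀ (‖X‖ ^ 2)` corrected by the boundary local time `μ`. -/
theorem tendsto_pathwise_expansion {p₀ p₁ p₂ : ℝ → ℝ} {C σ d V : ℝ} (hC : 0 ≤ C) (hσ : 0 ≤ σ)
    (hp : TaylorOnUnit p₀ p₁ p₂ C) {μ : Measure ℝ≥0} {t : ℝ≥0} (hμ : ∀ s, μ (Set.Iic s) < ∞)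
    (hμ0 : μ {0} = 0) {X W : ℝ≥0 → E} (hX : Continuous X) (hX1 : ∀ s, ‖X s‖ ≤ 1)
    (hW : Continuous W) (hμX : μ {s | ‖X s‖ < 1} = 0)
    (heq : ∀ s, X s = X 0 + σ • W s - ∫ r in Set.Iic s, X r ∂μ)
    {ns : ℕ → ℕ} (hns : Tendsto ns atTop atTop)
    (hV : Tendsto (fun j => ∑ i ∈ Finset.range (ns j + 1),
      ‖W (gridPoint t (ns j) (i + 1)) - W (gridPoint t (ns j) i)‖ ^ 2) atTop (𝓝 V))
    (hQ : Tendsto (fun j => ∑ i ∈ Finset.range (ns j + 1),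
      (p₁ (‖X (gridPoint t (ns j) i)‖ ^ 2) *
          ‖W (gridPoint t (ns j) (i + 1)) - W (gridPoint t (ns j) i)‖ ^ 2 +
        2 * p₂ (‖X (gridPoint t (ns j) i)‖ ^ 2) * ⟪X (gridPoint t (ns j) i),
          W (gridPoint t (ns j) (i + 1)) - W (gridPoint t (ns j) i)⟫ ^ 2 -
        t / (ns j + 1) * (d * p₁ (‖X (gridPoint t (ns j) i)‖ ^ 2) +
          2 * ‖X (gridPoint t (ns j) i)‖ ^ 2 * p₂ (‖X (gridPoint t (ns j) i)‖ ^ 2)))) atTop (𝓝 0)) :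
    Tendsto (fun j => 2 * σ * (∑ i ∈ Finset.range (ns j + 1),
        p₁ (‖X (gridPoint t (ns j) i)‖ ^ 2) * ⟪X (gridPoint t (ns j) i),
          W (gridPoint t (ns j) (i + 1)) - W (gridPoint t (ns j) i)⟫) +
      σ ^ 2 * (∑ i ∈ Finset.range (ns j + 1),
        t / (ns j + 1) * (d * p₁ (‖X (gridPoint t (ns j) i)‖ ^ 2) +
          2 * ‖X (gridPoint t (ns j) i)‖ ^ 2 * p₂ (‖X (gridPoint t (ns j) i)‖ ^ 2)))) atTop
      (𝓝 (p₀ (‖X t‖ ^ 2) - p₀ (‖X 0‖ ^ 2) + 2 * p₁ 1 * μ.real (Set.Iic t))) := by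
  set x : ℕ → ℕ → E := fun N i => X (gridPoint t N i) with hxdef
  set ξ : ℕ → ℕ → E := fun N i => W (gridPoint t N (i + 1)) - W (gridPoint t N i) with hξdef
  set A : ℕ → ℕ → E := fun N i =>
    ∫ s in Set.Ioc (gridPoint t N i) (gridPoint t N (i + 1)), X s ∂μ with hAdef
  have hstep : ∀ N i, x N (i + 1) - x N i = σ • ξ N i - A N i := by
    intro N i
    have hle := monotone_gridPoint t N i.le_succ
    have h1 : ∫ s in Set.Iic (gridPoint t N (i + 1)), X s ∂μ =
        (∫ s in Set.Iic (gridPoint t N i), X s ∂μ) + A N i := by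
      rw [← Set.Iic_union_Ioc_eq_Iic hle, setIntegral_union
        (Set.Iic_disjoint_Ioc le_rfl) measurableSet_Ioc
        (integrableOn_Iic_of_norm_le_one (hμ _) hX hX1)
        ((integrableOn_Iic_of_norm_le_one (hμ _) hX hX1).mono_set Set.Ioc_subset_Iic_self)]
    simp only [hxdef, hξdef]
    rw [heq (gridPoint t N (i + 1)), heq (gridPoint t N i), h1, smul_sub]
    abel
  set Λ := μ.real (Set.Iic t) with hΛ
  -- `μ` is carried by the times at which `‖X‖ = 1`, where the integrand equals `p₁ 1`.
  have hB : Tendsto (fun N : ℕ => ∑ i ∈ Finset.range (N + 1), p₁ (‖x N i‖ ^ 2) * ⟪x N i, A N i⟫)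
      atTop (𝓝 (p₁ 1 * Λ)) := by
    have hc := hp.continuous₁
    have h1 := tendsto_stieltjes_sum (hμ t) hμ0 hX hX1
      (v := fun s => p₁ (‖X s‖ ^ 2) • X s) (by fun_prop)
    have h2 : ∫ s in Set.Iic t, ⟪p₁ (‖X s‖ ^ 2) • X s, X s⟫ ∂μ = p₁ 1 * Λ := by
      have : ∀ᵐ s ∂μ.restrict (Set.Iic t), ⟪p₁ (‖X s‖ ^ 2) • X s, X s⟫ = p₁ 1 := by
        refine ae_restrict_of_ae ?_
        have h3 : ∀ᵐ s ∂μ, ¬ ‖X s‖ < 1 := by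
          rw [ae_iff]
          simpa using hμX
        filter_upwards [h3] with s hs
        rw [real_inner_smul_left, real_inner_self_eq_norm_sq,
          le_antisymm (hX1 s) (not_lt.1 hs)]
        simp
      rw [integral_congr_ae this, setIntegral_const, smul_eq_mul, mul_comm]
    rw [h2] at h1
    refine h1.congr fun N => Finset.sum_congr rfl fun i _ => ?_
    rw [real_inner_smul_left]
  set Err : ℕ → ℝ := fun N => p₀ (‖X t‖ ^ 2) - p₀ (‖X 0‖ ^ 2) -
      2 * σ * (∑ i ∈ Finset.range (N + 1), p₁ (‖x N i‖ ^ 2) * ⟪x N i, ξ N i⟫) +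
      2 * (∑ i ∈ Finset.range (N + 1), p₁ (‖x N i‖ ^ 2) * ⟪x N i, A N i⟫) -
      σ ^ 2 * (∑ i ∈ Finset.range (N + 1),
        (p₁ (‖x N i‖ ^ 2) * ‖ξ N i‖ ^ 2 + 2 * p₂ (‖x N i‖ ^ 2) * ⟪x N i, ξ N i⟫ ^ 2)) with hErr
  have hosc : ∀ ε : ℝ, 0 < ε → ε ≤ 1 → ∀ᶠ N in atTop,
      |Err N| ≤ ε * ((20 * C * σ ^ 2) * (∑ i ∈ Finset.range (N + 1), ‖ξ N i‖ ^ 2) +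
        (23 * C + 6 * C * σ) * Λ) := by
    intro ε hε hε1
    -- If the oscillations of `X` and `W` are at most `ε / (1 + σ)`, the increments of `∫ X dμ` are
    -- at most `ε`.
    set η := ε / (1 + σ) with hη
    have hη0 : 0 < η := by positivity
    have hηε : η ≤ ε := div_le_self hε.le (by linarith)
    have hση : η + σ * η = ε := by
      rw [hη]
      field_simp
    filter_upwards [eventually_grid_oscillation hX t hη0,
      eventually_grid_oscillation hW t hη0] with N h1 h2
    have hle : ∀ i, gridPoint t N (i + 1) ∈ Set.Icc (gridPoint t N i) (gridPoint t N (i + 1)) :=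
      fun i => ⟨monotone_gridPoint t N i.le_succ, le_rfl⟩
    have hxη : ∀ i < N + 1, ‖x N (i + 1) - x N i‖ ≤ η := fun i hi => by
      rw [← dist_eq_norm]
      exact h1 i hi _ (hle i)
    have hξη : ∀ i < N + 1, ‖ξ N i‖ ≤ η := fun i hi => by
      rw [← dist_eq_norm]
      exact h2 i hi _ (hle i)
    have hAε : ∀ i < N + 1, ‖A N i‖ ≤ ε := fun i hi => by
      have : A N i = σ • ξ N i - (x N (i + 1) - x N i) := by
        rw [hstep]
        abel
      rw [this]
      refine (norm_sub_le _ _).trans ?_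
      rw [norm_smul, Real.norm_of_nonneg hσ]
      have := mul_le_mul_of_nonneg_left (hξη i hi) hσ
      linarith [hxη i hi]
    have key := taylor_sum hC hσ hp (x := x N) (ξ := ξ N) (A := A N) (M := N + 1)
      (fun i => hX1 _) (fun i _ => hstep N i) hε.le hε1 (fun i hi => (hxη i hi).trans hηε)
      (fun i hi => (hξη i hi).trans hηε) hAε
    have e1 : x N (N + 1) = X t := by simp only [hxdef, gridPoint_last]
    have e2 : x N 0 = X 0 := by simp only [hxdef, gridPoint_zero]
    rw [e1, e2] at key
    refine key.trans ?_
    have := sum_norm_setIntegral_grid_le (hμ t) hX hX1 N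
    gcongr
  have hErr0 : Tendsto (fun j => Err (ns j)) atTop (𝓝 0) := by
    set B := (20 * C * σ ^ 2) * (V + 1) + (23 * C + 6 * C * σ) * Λ with hBdef
    have hVlt := hV.eventually_lt_const (lt_add_one V)
    have hV0 : 0 ≤ V := ge_of_tendsto' hV fun j => Finset.sum_nonneg fun i _ => by positivity
    have hB0 : 0 ≤ B := by positivity
    rw [Metric.tendsto_nhds]
    intro ε hε
    set ε' := min 1 (ε / (2 * (B + 1))) with hε'
    have hε'0 : 0 < ε' := lt_min one_pos (by positivity)
    filter_upwards [hVlt, hns.eventually (hosc ε' hε'0 (min_le_left _ _))] with j h1 h2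
    rw [dist_zero_right, Real.norm_eq_abs]
    have h3 : ε' * B < ε := by
      have h4 : ε' * B ≤ ε / (2 * (B + 1)) * B := mul_le_mul_of_nonneg_right (min_le_right _ _) hB0
      refine h4.trans_lt ?_
      rw [div_mul_eq_mul_div, div_lt_iff₀ (by positivity)]
      nlinarith
    refine (h2.trans ?_).trans_lt h3
    have h1' : ∑ i ∈ Finset.range (ns j + 1), ‖ξ (ns j) i‖ ^ 2 ≤ V + 1 := h1.le
    rw [hBdef]
    gcongr
  have hfin := ((tendsto_const_nhds (x := p₀ (‖X t‖ ^ 2) - p₀ (‖X 0‖ ^ 2))).add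
    ((hB.comp hns).const_mul 2)).sub ((hQ.const_mul (σ ^ 2)).add hErr0)
  have hlim : p₀ (‖X t‖ ^ 2) - p₀ (‖X 0‖ ^ 2) + 2 * (p₁ 1 * Λ) - (σ ^ 2 * 0 + 0) =
      p₀ (‖X t‖ ^ 2) - p₀ (‖X 0‖ ^ 2) + 2 * p₁ 1 * Λ := by ring
  rw [hlim] at hfin
  refine hfin.congr fun j => ?_
  simp only [hErr, Function.comp_apply, hxdef, hξdef, Finset.sum_sub_distrib]
  ring

end Stieltjes

/-! ### Itô's formula in expectation -/

theorem euclidean_inner_eq_sum {n : ℕ} (x y : EuclideanSpace ℝ (Fin n)) :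
    inner ℝ x y = ∑ a, x a * y a := by
  simp [PiLp.inner_apply, mul_comm]

theorem sum_quadratic_innovations {n : ℕ} (x ξ : EuclideanSpace ℝ (Fin n)) (q₁ q₂ Δ : ℝ) :
    ∑ j : Fin n × Fin n, ((if j.1 = j.2 then q₁ else 0) + 2 * q₂ * (x j.1 * x j.2)) *
      (ξ j.1 * ξ j.2 - if j.1 = j.2 then Δ else 0) =
    q₁ * ‖ξ‖ ^ 2 + 2 * q₂ * (inner ℝ x ξ) ^ 2 - Δ * (n * q₁ + 2 * ‖x‖ ^ 2 * q₂) := by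
  have h1 : ∀ a b : Fin n, ((if a = b then q₁ else 0) + 2 * q₂ * (x a * x b)) *
      (ξ a * ξ b - if a = b then Δ else 0) =
      (if a = b then q₁ * (ξ a * ξ b) - q₁ * Δ - 2 * q₂ * Δ * (x a * x b) else 0) +
        2 * q₂ * ((x a * ξ a) * (x b * ξ b)) := by
    intro a b
    split_ifs <;> ring
  have h2 : ∀ y : EuclideanSpace ℝ (Fin n), ‖y‖ ^ 2 = ∑ a, y a * y a := by
    intro y
    rw [← real_inner_self_eq_norm_sq, euclidean_inner_eq_sum]
  rw [Fintype.sum_prod_type]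
  simp only [h1, Finset.sum_add_distrib, Finset.sum_ite_eq, Finset.mem_univ, if_true,
    Finset.sum_sub_distrib, ← Finset.mul_sum, ← Finset.sum_mul]
  rw [h2, h2, euclidean_inner_eq_sum, Finset.sum_const, Finset.card_univ, Fintype.card_fin,
    nsmul_eq_mul]
  ring

theorem abs_apply_le_norm {n : ℕ} (x : EuclideanSpace ℝ (Fin n)) (a : Fin n) : |x a| ≤ ‖x‖ := by
  rw [← Real.norm_eq_abs]
  exact PiLp.norm_apply_le x a

section

variable {Ω : Type*} {mΩ : MeasurableSpace Ω} {P : Measure Ω} {n : ℕ} {β : ℝ}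
  {𝓕 : Filtration ℝ≥0 mΩ} {W X : ℝ≥0 → Ω → EuclideanSpace ℝ (Fin n)} {L : Ω → Measure ℝ≥0}

theorem IsBrownian.indep_comp_increment (hW : IsBrownian P 𝓕 W) {s t : ℝ≥0} (hst : s ≤ t)
    {f : EuclideanSpace ℝ (Fin n) → ℝ} (hf : Measurable f) :
    Indep (MeasurableSpace.comap (fun ω => f (W t ω - W s ω)) inferInstance) (𝓕 s) P :=
  indep_of_indep_of_le_left (hW.indep_increment s t hst)
    (hf.comp (comap_measurable fun ω => W t ω - W s ω)).comap_le

theorem IsBrownian.measurable_increment (hW : IsBrownian P 𝓕 W) {s t : ℝ≥0} (hst : s ≤ t) :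
    Measurable[𝓕 t] fun ω => W t ω - W s ω :=
  (hW.adapted t).sub ((hW.adapted s).mono (𝓕.mono hst) le_rfl)

theorem IsBrownian.continuous_paths (hW : IsBrownian P 𝓕 W) :
    ∀ᵐ ω ∂P, Continuous fun t => W t ω := by
  filter_upwards [ae_all_iff.2 fun i => (hW.coord i).cont] with ω hω
  exact (PiLp.continuous_toLp 2 _).comp (continuous_pi hω)

/-- The discretized stochastic integral of `p₁ (‖X‖ ^ 2) X` against `W`. -/
noncomputable def martingaleSum (p₁ : ℝ → ℝ) (W X : ℝ≥0 → Ω → EuclideanSpace ℝ (Fin n)) (t : ℝ≥0)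
    (N : ℕ) (ω : Ω) : ℝ :=
  ∑ i ∈ Finset.range (N + 1), p₁ (‖X (gridPoint t N i) ω‖ ^ 2) *
    inner ℝ (X (gridPoint t N i) ω) (W (gridPoint t N (i + 1)) ω - W (gridPoint t N i) ω)

/-- The difference between the discretized quadratic variation term in the expansion of
`p₀ (‖X‖ ^ 2)` and its compensator. -/
noncomputable def quadraticSum (p₁ p₂ : ℝ → ℝ) (W X : ℝ≥0 → Ω → EuclideanSpace ℝ (Fin n)) (t : ℝ≥0)
    (N : ℕ) (ω : Ω) : ℝ :=
  ∑ i ∈ Finset.range (N + 1),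
    (p₁ (‖X (gridPoint t N i) ω‖ ^ 2) *
        ‖W (gridPoint t N (i + 1)) ω - W (gridPoint t N i) ω‖ ^ 2 +
      2 * p₂ (‖X (gridPoint t N i) ω‖ ^ 2) * (inner ℝ (X (gridPoint t N i) ω)
        (W (gridPoint t N (i + 1)) ω - W (gridPoint t N i) ω)) ^ 2 -
      t / (N + 1) * (n * p₁ (‖X (gridPoint t N i) ω‖ ^ 2) +
        2 * ‖X (gridPoint t N i) ω‖ ^ 2 * p₂ (‖X (gridPoint t N i) ω‖ ^ 2)))

/-- Half the Laplacian of `x ↦ p₀ (‖x‖ ^ 2)` on `ℝⁿ`, where `p₁ = p₀'` and `p₂ = p₀''`. -/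
noncomputable def halfLaplacian (n : ℕ) (p₁ p₂ : ℝ → ℝ) (x : EuclideanSpace ℝ (Fin n)) : ℝ :=
  n * p₁ (‖x‖ ^ 2) + 2 * ‖x‖ ^ 2 * p₂ (‖x‖ ^ 2)

theorem continuous_halfLaplacian {p₀ p₁ p₂ : ℝ → ℝ} {C : ℝ} (hp : TaylorOnUnit p₀ p₁ p₂ C) :
    Continuous (halfLaplacian n p₁ p₂) := by
  have := hp.continuous₁
  have := hp.continuous₂
  unfold halfLaplacian
  fun_prop

theorem sq_norm_mem_Icc {x : EuclideanSpace ℝ (Fin n)} (hx : ‖x‖ ≤ 1) :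
    ‖x‖ ^ 2 ∈ Set.Icc (0 : ℝ) 1 :=
  ⟨sq_nonneg _, pow_le_one₀ (norm_nonneg _) hx⟩

theorem abs_halfLaplacian_le {p₀ p₁ p₂ : ℝ → ℝ} {C : ℝ} (hp : TaylorOnUnit p₀ p₁ p₂ C)
    {x : EuclideanSpace ℝ (Fin n)} (hx : ‖x‖ ≤ 1) : |halfLaplacian n p₁ p₂ x| ≤ (n + 2) * C := by
  have h := sq_norm_mem_Icc hx
  refine (abs_add_le _ _).trans ?_
  rw [abs_mul, abs_mul, abs_of_nonneg (by positivity : (0 : ℝ) ≤ n),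
    abs_of_nonneg (by positivity : 0 ≤ 2 * ‖x‖ ^ 2), add_mul]
  have h1 := hp.abs_le₁ _ h
  have h2 := hp.abs_le₂ _ h
  have h3 : 2 * ‖x‖ ^ 2 ≤ 2 := by linarith [h.2]
  gcongr

theorem IsReflectedSolution.martingaleSum_moments [IsProbabilityMeasure P]
    (h : IsReflectedSolution β P 𝓕 W L X) {p₀ p₁ p₂ : ℝ → ℝ} {C : ℝ} (hC : 0 ≤ C)
    (hp : TaylorOnUnit p₀ p₁ p₂ C) (t : ℝ≥0) (N : ℕ) :
    MemLp (martingaleSum p₁ W X t N) 2 P ∧ ∫ ω, martingaleSum p₁ W X t N ω ∂P = 0 ∧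
      ∫ ω, martingaleSum p₁ W X t N ω ^ 2 ∂P ≤ (n : ℝ) ^ 2 * C ^ 2 * t := by
  have hW := h.brownian
  have hmono := monotone_gridPoint t N
  have hle := fun i => hmono (Nat.le_succ i)
  have hc := hp.continuous₁
  have key := predictable_sum (P := P) (F := fun i => 𝓕 (gridPoint t N i))
    (α := fun i (a : Fin n) ω => p₁ (‖X (gridPoint t N i) ω‖ ^ 2) * X (gridPoint t N i) ω a)
    (ζ := fun i (a : Fin n) ω => W (gridPoint t N (i + 1)) ω a - W (gridPoint t N i) ω a)
    (C := C) (v := t / (N + 1)) (fun i j hij => 𝓕.mono (hmono hij)) (fun i => 𝓕.le _)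
    (fun i a => by
      have : Measurable fun x : EuclideanSpace ℝ (Fin n) => p₁ (‖x‖ ^ 2) * x a := by fun_prop
      exact this.comp (h.adapted _))
    (fun i a => by
      filter_upwards [h.mem_ball] with ω hω
      rw [abs_mul, ← mul_one C]
      exact mul_le_mul (hp.abs_le₁ _ (sq_norm_mem_Icc (hω _)))
        ((abs_apply_le_norm _ _).trans (hω _)) (abs_nonneg _) hC)
    (fun i a => by
      have : Measurable fun x : EuclideanSpace ℝ (Fin n) => x a := by fun_prop
      exact this.comp (hW.measurable_increment (hle i)))
    (fun i a => hW.indep_comp_increment (hle i) (f := fun x => x a) (by fun_prop))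
    (fun i a => hW.memLp_increment (hle i) a 2) (fun i a => hW.integral_increment (hle i) a)
    (fun i a => (hW.integral_increment_sq (hle i) a).trans_le (gridPoint_succ_sub t N i).le)
    (N + 1)
  have e : (fun ω => ∑ i ∈ Finset.range (N + 1), ∑ a,
      p₁ (‖X (gridPoint t N i) ω‖ ^ 2) * X (gridPoint t N i) ω a *
        (W (gridPoint t N (i + 1)) ω a - W (gridPoint t N i) ω a)) =
      martingaleSum p₁ W X t N := by
    funext ω
    refine Finset.sum_congr rfl fun i _ => ?_
    rw [euclidean_inner_eq_sum, Finset.mul_sum]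
    simp only [PiLp.sub_apply, mul_assoc]
  obtain ⟨k1, k2, k3⟩ := key
  have e' := fun ω => congrFun e ω
  simp only [e] at k1
  simp only [e'] at k2 k3
  refine ⟨k1, k2, k3.trans_eq ?_⟩
  rw [Fintype.card_fin]
  push_cast
  field_simp

theorem IsReflectedSolution.quadraticSum_moments [IsProbabilityMeasure P]
    (h : IsReflectedSolution β P 𝓕 W L X) {p₀ p₁ p₂ : ℝ → ℝ} {C : ℝ} (hC : 0 ≤ C)
    (hp : TaylorOnUnit p₀ p₁ p₂ C) (t : ℝ≥0) (N : ℕ) :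
    MemLp (quadraticSum p₁ p₂ W X t N) 2 P ∧
      ∫ ω, quadraticSum p₁ p₂ W X t N ω ^ 2 ∂P ≤
        ((n : ℝ) ^ 4 * (3 * C) ^ 2 * ((2 * gaussianFourthMoment + 2) * t ^ 2)) / (N + 1) := by
  have hW := h.brownian
  have hmono := monotone_gridPoint t N
  have hle := fun i => hmono (Nat.le_succ i)
  have hc := hp.continuous₁
  have hc2 := hp.continuous₂
  set Δ : ℝ := t / (N + 1) with hΔ
  have key := predictable_sum (P := P) (F := fun i => 𝓕 (gridPoint t N i))
    (α := fun i (j : Fin n × Fin n) ω =>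
      (if j.1 = j.2 then p₁ (‖X (gridPoint t N i) ω‖ ^ 2) else 0) +
      2 * p₂ (‖X (gridPoint t N i) ω‖ ^ 2) *
        (X (gridPoint t N i) ω j.1 * X (gridPoint t N i) ω j.2))
    (ζ := fun i (j : Fin n × Fin n) ω =>
      (W (gridPoint t N (i + 1)) ω j.1 - W (gridPoint t N i) ω j.1) *
      (W (gridPoint t N (i + 1)) ω j.2 - W (gridPoint t N i) ω j.2) -
      if j.1 = j.2 then Δ else 0)
    (C := 3 * C) (v := (2 * gaussianFourthMoment + 2) * Δ ^ 2)
    (fun i j hij => 𝓕.mono (hmono hij)) (fun i => 𝓕.le _)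
    (fun i j => by
      have : Measurable fun x : EuclideanSpace ℝ (Fin n) =>
          (if j.1 = j.2 then p₁ (‖x‖ ^ 2) else 0) + 2 * p₂ (‖x‖ ^ 2) * (x j.1 * x j.2) := by
        split_ifs <;> fun_prop
      exact this.comp (h.adapted _))
    (fun i j => by
      filter_upwards [h.mem_ball] with ω hω
      have hs := sq_norm_mem_Icc (hω (gridPoint t N i))
      have h1 := hp.abs_le₁ _ hs
      have h2 := hp.abs_le₂ _ hs
      have h3 : |X (gridPoint t N i) ω j.1 * X (gridPoint t N i) ω j.2| ≤ 1 := by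
        rw [abs_mul]
        exact mul_le_one₀ ((abs_apply_le_norm _ _).trans (hω _)) (abs_nonneg _)
          ((abs_apply_le_norm _ _).trans (hω _))
      refine (abs_add_le _ _).trans ?_
      have h4 : |if j.1 = j.2 then p₁ (‖X (gridPoint t N i) ω‖ ^ 2) else 0| ≤ C := by
        split_ifs
        · exact h1
        · rwa [abs_zero]
      have h5 : |2 * p₂ (‖X (gridPoint t N i) ω‖ ^ 2) *
          (X (gridPoint t N i) ω j.1 * X (gridPoint t N i) ω j.2)| ≤ 2 * C * 1 := by
        rw [abs_mul, abs_mul, abs_two]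
        exact mul_le_mul (by linarith) h3 (abs_nonneg _) (by linarith)
      linarith)
    (fun i j => by
      have : Measurable fun x : EuclideanSpace ℝ (Fin n) =>
        x j.1 * x j.2 - if j.1 = j.2 then Δ else 0 := by fun_prop
      exact this.comp (hW.measurable_increment (hle i)))
    (fun i j => hW.indep_comp_increment (hle i)
      (f := fun x => x j.1 * x j.2 - if j.1 = j.2 then Δ else 0) (by fun_prop))
    (fun i j => (hW.memLp_increment_mul (hle i) j.1 j.2).sub (memLp_const _))
    (fun i j => by
      rw [integral_sub ((hW.memLp_increment_mul (hle i) j.1 j.2).integrable one_le_two)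
        (integrable_const _), hW.integral_increment_mul (hle i), gridPoint_succ_sub t N i]
      simp [hΔ])
    (fun i j => by
      have hL := hW.memLp_increment_mul (hle i) j.1 j.2
      have hsq := hW.integral_increment_mul_sq_le (hle i) j.1 j.2
      rw [gridPoint_succ_sub t N i] at hsq
      have hpt : ∀ ω, ((W (gridPoint t N (i + 1)) ω j.1 - W (gridPoint t N i) ω j.1) *
          (W (gridPoint t N (i + 1)) ω j.2 - W (gridPoint t N i) ω j.2) -
          if j.1 = j.2 then Δ else 0) ^ 2 ≤
          2 * ((W (gridPoint t N (i + 1)) ω j.1 - W (gridPoint t N i) ω j.1) *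
          (W (gridPoint t N (i + 1)) ω j.2 - W (gridPoint t N i) ω j.2)) ^ 2 + 2 * Δ ^ 2 := by
        intro ω
        have : (if j.1 = j.2 then Δ else 0) ^ 2 ≤ Δ ^ 2 := by
          split_ifs
          · exact le_rfl
          · simpa using sq_nonneg Δ
        nlinarith [sq_nonneg ((W (gridPoint t N (i + 1)) ω j.1 - W (gridPoint t N i) ω j.1) *
          (W (gridPoint t N (i + 1)) ω j.2 - W (gridPoint t N i) ω j.2) +
          if j.1 = j.2 then Δ else 0)]
      refine (integral_mono (hL.sub (memLp_const _)).integrable_sq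
        ((hL.integrable_sq.const_mul 2).add (integrable_const _)) hpt).trans ?_
      rw [integral_add' (hL.integrable_sq.const_mul 2) (integrable_const _), integral_const_mul]
      simp only [integral_const, probReal_univ, one_smul]
      linarith)
    (N + 1)
  have e : ∀ ω, (∑ i ∈ Finset.range (N + 1), ∑ j : Fin n × Fin n,
      ((if j.1 = j.2 then p₁ (‖X (gridPoint t N i) ω‖ ^ 2) else 0) +
        2 * p₂ (‖X (gridPoint t N i) ω‖ ^ 2) *
          (X (gridPoint t N i) ω j.1 * X (gridPoint t N i) ω j.2)) *
      ((W (gridPoint t N (i + 1)) ω j.1 - W (gridPoint t N i) ω j.1) *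
        (W (gridPoint t N (i + 1)) ω j.2 - W (gridPoint t N i) ω j.2) -
        if j.1 = j.2 then Δ else 0)) = quadraticSum p₁ p₂ W X t N ω := by
    intro ω
    refine Finset.sum_congr rfl fun i _ => ?_
    exact sum_quadratic_innovations (X (gridPoint t N i) ω)
      (W (gridPoint t N (i + 1)) ω - W (gridPoint t N i) ω) _ _ Δ
  obtain ⟨k1, -, k3⟩ := key
  simp only [e] at k1 k3
  refine ⟨k1, k3.trans_eq ?_⟩
  rw [Fintype.card_prod, Fintype.card_fin, hΔ]
  push_cast
  field_simp

theorem IsReflectedSolution.quadraticSum_tendsto_zero [IsProbabilityMeasure P]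
    (h : IsReflectedSolution β P 𝓕 W L X) {p₀ p₁ p₂ : ℝ → ℝ} {C : ℝ} (hC : 0 ≤ C)
    (hp : TaylorOnUnit p₀ p₁ p₂ C) (t : ℝ≥0) :
    Tendsto (fun N => ∫ ω, quadraticSum p₁ p₂ W X t N ω ^ 2 ∂P) atTop (𝓝 0) :=
  squeeze_zero (fun _ => integral_nonneg fun _ => sq_nonneg _)
    (fun N => (h.quadraticSum_moments hC hp t N).2)
    (tendsto_const_nhds.div_atTop (tendsto_natCast_atTop_atTop.atTop_add tendsto_const_nhds))

/-- There is a sequence of partitions along which both the plain and the weighted quadratic variation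
of the driving Brownian motion converge almost surely. -/
theorem IsReflectedSolution.exists_partition_seq [IsProbabilityMeasure P]
    (h : IsReflectedSolution β P 𝓕 W L X) {p₀ p₁ p₂ : ℝ → ℝ} {C : ℝ} (hC : 0 ≤ C)
    (hp : TaylorOnUnit p₀ p₁ p₂ C) (t : ℝ≥0) :
    ∃ ns : ℕ → ℕ, Tendsto ns atTop atTop ∧
      (∀ᵐ ω ∂P, Tendsto (fun j => quadraticSum p₁ p₂ W X t (ns j) ω) atTop (𝓝 0)) ∧
      ∀ᵐ ω ∂P, Tendsto (fun j => ∑ i ∈ Finset.range (ns j + 1),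
        ‖W (gridPoint t (ns j) (i + 1)) ω - W (gridPoint t (ns j) i) ω‖ ^ 2) atTop
          (𝓝 (n * t)) := by
  obtain ⟨ns, hns, h1⟩ := exists_subseq_tendsto_zero_of_integral_sq
    (fun N => (h.quadraticSum_moments hC hp t N).1) (h.quadraticSum_tendsto_zero hC hp t)
  obtain ⟨ms, hms, h2⟩ := exists_subseq_tendsto_zero_of_integral_sq
    (fun j => (h.quadraticSum_moments zero_le_one taylorOnUnit_id t (ns j)).1)
    ((h.quadraticSum_tendsto_zero zero_le_one taylorOnUnit_id t).comp hns.tendsto_atTop)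
  refine ⟨ns ∘ ms, hns.tendsto_atTop.comp hms.tendsto_atTop,
    h1.mono fun ω hω => hω.comp hms.tendsto_atTop, h2.mono fun ω hω => ?_⟩
  have := hω.add_const (n * t : ℝ)
  rw [zero_add] at this
  refine this.congr fun j => ?_
  simp only [quadraticSum, Function.comp_apply, one_mul, mul_zero, zero_mul, add_zero, mul_one,
    Finset.sum_sub_distrib, Finset.sum_const, Finset.card_range, nsmul_eq_mul]
  push_cast
  field_simp
  ring

/-- Itô's formula for `p₀ (‖X‖ ^ 2)` in expectation. The integrability of the local time, when
`p₁ 1 ≠ 0`, is part of the conclusion. -/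
theorem IsReflectedSolution.integral_expansion [IsProbabilityMeasure P] (hβ : 0 < β)
    (h : IsReflectedSolution β P 𝓕 W L X) {p₀ p₁ p₂ : ℝ → ℝ} {C : ℝ} (hC : 0 ≤ C)
    (hp : TaylorOnUnit p₀ p₁ p₂ C) (t : ℝ≥0) :
    Integrable (fun ω => p₀ (‖X t ω‖ ^ 2) - p₀ (‖X 0 ω‖ ^ 2) +
      2 * p₁ 1 * (L ω).real (Set.Iic t)) P ∧
    ∫ ω, (p₀ (‖X t ω‖ ^ 2) - p₀ (‖X 0 ω‖ ^ 2) + 2 * p₁ 1 * (L ω).real (Set.Iic t)) ∂P =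
      2 / β * ∫ s in (0 : ℝ)..t, ∫ ω, halfLaplacian n p₁ p₂ (X s.toNNReal ω) ∂P := by
  obtain ⟨ns, hns, hQ, hV⟩ := h.exists_partition_seq hC hp t
  set σ := √(2 / β) with hσdef
  have hσ : 0 ≤ σ := Real.sqrt_nonneg _
  have hσ2 : σ ^ 2 = 2 / β := Real.sq_sqrt (by positivity)
  have hgc := continuous_halfLaplacian (n := n) hp
  have hXm : ∀ s, Measurable (X s) := fun s => (h.adapted s).mono (𝓕.le s) le_rfl
  set B : ℝ := (n + 2) * C with hB
  have hB0 : 0 ≤ B := by positivity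
  have hgb : ∀ s, ∀ᵐ ω ∂P, ‖halfLaplacian n p₁ p₂ (X s ω)‖ ≤ B := fun s => by
    filter_upwards [h.mem_ball] with ω hω
    exact abs_halfLaplacian_le hp (hω s)
  have hgi : ∀ s, Integrable (fun ω => halfLaplacian n p₁ p₂ (X s ω)) P := fun s =>
    Integrable.of_bound (hgc.measurable.comp (hXm s)).aestronglyMeasurable B (hgb s)
  set R : ℕ → Ω → ℝ := fun N ω => ∑ i ∈ Finset.range (N + 1),
    (t / (N + 1) : ℝ) * halfLaplacian n p₁ p₂ (X (gridPoint t N i) ω) with hR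
  have hRm : ∀ N, Measurable (R N) := fun N =>
    Finset.measurable_sum _ fun i _ => (hgc.measurable.comp (hXm _)).const_mul _
  have hRb : ∀ N, ∀ᵐ ω ∂P, ‖R N ω‖ ≤ t * B := by
    intro N
    filter_upwards [h.mem_ball] with ω hω
    refine (norm_sum_le _ _).trans ?_
    have : ∀ i ∈ Finset.range (N + 1), ‖(t / (N + 1) : ℝ) *
        halfLaplacian n p₁ p₂ (X (gridPoint t N i) ω)‖ ≤ t / (N + 1) * B := by
      intro i _
      rw [norm_mul, Real.norm_of_nonneg (by positivity)]
      exact mul_le_mul_of_nonneg_left (abs_halfLaplacian_le hp (hω _)) (by positivity)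
    refine (Finset.sum_le_sum this).trans_eq ?_
    rw [Finset.sum_const, Finset.card_range, nsmul_eq_mul]
    push_cast
    field_simp
  have hRL : ∀ N, MemLp (R N) 2 P := fun N =>
    MemLp.of_bound (hRm N).aestronglyMeasurable _ (hRb N)
  set Z : ℕ → Ω → ℝ := fun j ω => 2 * σ * martingaleSum p₁ W X t (ns j) ω + σ ^ 2 * R (ns j) ω
    with hZ
  have hM := fun N => h.martingaleSum_moments hC hp t N
  have hZL : ∀ j, MemLp (Z j) 2 P := fun j =>
    ((hM (ns j)).1.const_mul _).add ((hRL (ns j)).const_mul _)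
  have hZsq : ∀ j, ∫ ω, Z j ω ^ 2 ∂P ≤
      8 * σ ^ 2 * ((n : ℝ) ^ 2 * C ^ 2 * t) + 2 * σ ^ 4 * (t * B) ^ 2 := by
    intro j
    have hpt : ∀ᵐ ω ∂P, Z j ω ^ 2 ≤
        8 * σ ^ 2 * martingaleSum p₁ W X t (ns j) ω ^ 2 + 2 * σ ^ 4 * (t * B) ^ 2 := by
      filter_upwards [hRb (ns j)] with ω hω
      have h1 : R (ns j) ω ^ 2 ≤ (t * B) ^ 2 := by
        rw [← sq_abs]
        exact pow_le_pow_left₀ (abs_nonneg _) hω 2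
      have h2 : 2 * σ ^ 4 * R (ns j) ω ^ 2 ≤ 2 * σ ^ 4 * (t * B) ^ 2 :=
        mul_le_mul_of_nonneg_left h1 (by positivity)
      simp only [hZ]
      nlinarith [sq_nonneg (2 * σ * martingaleSum p₁ W X t (ns j) ω - σ ^ 2 * R (ns j) ω)]
    have hi := (hM (ns j)).1.integrable_sq.const_mul (8 * σ ^ 2)
    refine (integral_mono_ae (hZL j).integrable_sq (hi.add (integrable_const _)) hpt).trans ?_
    rw [integral_add' hi (integrable_const _), integral_const_mul]
    simp only [integral_const, probReal_univ, one_smul]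
    have := mul_le_mul_of_nonneg_left (hM (ns j)).2.2 (by positivity : 0 ≤ 8 * σ ^ 2)
    linarith
  have hlim : ∀ᵐ ω ∂P, Tendsto (fun j => Z j ω) atTop
      (𝓝 (p₀ (‖X t ω‖ ^ 2) - p₀ (‖X 0 ω‖ ^ 2) + 2 * p₁ 1 * (L ω).real (Set.Iic t))) := by
    filter_upwards [hQ, hV, h.continuous_paths, h.mem_ball, h.localTime_finite,
      h.localTime_continuous, h.localTime_boundary, h.equation, h.brownian.continuous_paths]
      with ω h1 h2 h3 h4 h5 h6 h7 h8 h9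
    exact tendsto_pathwise_expansion hC hσ hp h5 (h6 0) h3 h4 h9 h7 h8 hns h2 h1
  obtain ⟨hint, htend⟩ := tendsto_integral_of_sq_bounded hZL hZsq hlim
  refine ⟨hint, tendsto_nhds_unique htend ?_⟩
  have hφ : Continuous fun s : ℝ≥0 => ∫ ω, halfLaplacian n p₁ p₂ (X s ω) ∂P := by
    refine continuous_of_dominated (fun s => (hgi s).aestronglyMeasurable) hgb
      (integrable_const B) ?_
    filter_upwards [h.continuous_paths] with ω hω
    exact hgc.comp hω
  have hriem := ((tendsto_riemann_sum hφ t).comp hns).const_mul (2 / β)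
  refine hriem.congr fun j => ?_
  have e1 : ∫ ω, Z j ω ∂P = σ ^ 2 * ∫ ω, R (ns j) ω ∂P := by
    simp only [hZ]
    rw [integral_add (((hM (ns j)).1.integrable one_le_two).const_mul _)
      (((hRL (ns j)).integrable one_le_two).const_mul _), integral_const_mul, integral_const_mul,
      (hM (ns j)).2.1, mul_zero, zero_add]
  rw [e1, hσ2, Function.comp_apply]
  congr 1
  simp only [hR]
  rw [integral_finsetSum _ fun i _ => (hgi _).const_mul _]
  refine Finset.sum_congr rfl fun i _ => ?_
  rw [integral_const_mul]

end

/-! ### Invariance of the radial law -/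

section

variable {Ω : Type*} {mΩ : MeasurableSpace Ω} {P : Measure Ω} {n : ℕ} {β : ℝ}
  {𝓕 : Filtration ℝ≥0 mΩ} {W X : ℝ≥0 → Ω → EuclideanSpace ℝ (Fin n)} {L : Ω → Measure ℝ≥0}

/-- The `k`-th moment of `‖X_t‖ ^ 2`. -/
noncomputable def radialMoment (P : Measure Ω) (X : ℝ≥0 → Ω → EuclideanSpace ℝ (Fin n)) (k : ℕ)
    (t : ℝ≥0) : ℝ :=
  ∫ ω, (‖X t ω‖ ^ 2) ^ k ∂P

theorem IsReflectedSolution.integrable_radial [IsProbabilityMeasure P]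
    (h : IsReflectedSolution β P 𝓕 W L X) (k : ℕ) (t : ℝ≥0) :
    Integrable (fun ω => (‖X t ω‖ ^ 2) ^ k) P := by
  have hm : Measurable (X t) := (h.adapted t).mono (𝓕.le t) le_rfl
  refine Integrable.of_bound (by fun_prop) 1 ?_
  filter_upwards [h.mem_ball] with ω hω
  have := sq_norm_mem_Icc (hω t)
  rw [Real.norm_of_nonneg (pow_nonneg this.1 _)]
  exact pow_le_one₀ this.1 this.2

theorem IsReflectedSolution.radialMoment_mem_Icc [IsProbabilityMeasure P]
    (h : IsReflectedSolution β P 𝓕 W L X) (k : ℕ) (t : ℝ≥0) :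
    radialMoment P X k t ∈ Set.Icc (0 : ℝ) 1 := by
  refine ⟨integral_nonneg fun ω => by positivity, ?_⟩
  have h1 : ∫ ω, (‖X t ω‖ ^ 2) ^ k ∂P ≤ ∫ _, (1 : ℝ) ∂P := by
    refine integral_mono_ae (h.integrable_radial k t) (integrable_const _) ?_
    filter_upwards [h.mem_ball] with ω hω
    have := sq_norm_mem_Icc (hω t)
    exact pow_le_one₀ this.1 this.2
  exact h1.trans_eq (by simp)

theorem IsReflectedSolution.continuous_radialMoment [IsProbabilityMeasure P]
    (h : IsReflectedSolution β P 𝓕 W L X) (k : ℕ) : Continuous (radialMoment P X k) := by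
  refine continuous_of_dominated (bound := fun _ => 1)
    (fun t => (h.integrable_radial k t).aestronglyMeasurable) (fun t => ?_) (integrable_const _) ?_
  · filter_upwards [h.mem_ball] with ω hω
    have := sq_norm_mem_Icc (hω t)
    rw [Real.norm_of_nonneg (pow_nonneg this.1 _)]
    exact pow_le_one₀ this.1 this.2
  · filter_upwards [h.continuous_paths] with ω hω
    fun_prop

theorem IsReflectedSolution.radialMoment_expansion [IsProbabilityMeasure P] (hβ : 0 < β)
    (h : IsReflectedSolution β P 𝓕 W L X) (k : ℕ) (t : ℝ≥0) :
    Integrable (fun ω => (‖X t ω‖ ^ 2) ^ (k + 1) - (‖X 0 ω‖ ^ 2) ^ (k + 1) +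
      2 * (k + 1) * (L ω).real (Set.Iic t)) P ∧
    ∫ ω, ((‖X t ω‖ ^ 2) ^ (k + 1) - (‖X 0 ω‖ ^ 2) ^ (k + 1) +
      2 * (k + 1) * (L ω).real (Set.Iic t)) ∂P =
    2 / β * ((k + 1) * (n + 2 * k)) * ∫ s in (0 : ℝ)..t, radialMoment P X k s.toNNReal := by
  obtain ⟨C, hC, hp⟩ := exists_taylorOnUnit_pow k
  have key := h.integral_expansion hβ hC hp t
  simp only [one_pow, mul_one] at key
  refine ⟨key.1, key.2.trans ?_⟩
  rw [mul_assoc]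
  congr 1
  rw [← intervalIntegral.integral_const_mul]
  refine intervalIntegral.integral_congr fun s _ => ?_
  rw [radialMoment, ← integral_const_mul]
  congr 1
  funext ω
  rw [halfLaplacian]
  rcases k with _ | k
  · simp
  · rw [Nat.add_sub_cancel, pow_succ _ k]
    push_cast
    ring

/-- The recursion for the deviations of the radial moments from those of `ν_n`, obtained by
eliminating the expected local time between the expansions of `‖X‖ ^ (2k+2)` and `‖X‖ ^ 2`. -/
theorem IsReflectedSolution.radialMoment_recursion [IsProbabilityMeasure P] (hn : 1 ≤ n)
    (hβ : 0 < β) (h : IsReflectedSolution β P 𝓕 W L X)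
    (h0 : ∀ k : ℕ, radialMoment P X k 0 = n / (n + 2 * k)) (k : ℕ) (t : ℝ≥0) :
    radialMoment P X (k + 1) t - n / (n + 2 * (k + 1 : ℕ)) =
      2 / β * ((k + 1) * (n + 2 * k)) *
        (∫ s in (0 : ℝ)..t, (radialMoment P X k s.toNNReal - n / (n + 2 * k))) +
      (k + 1) * (radialMoment P X 1 t - n / (n + 2 * (1 : ℕ))) := by
  have hn0 : (0 : ℝ) < n := by exact_mod_cast hn
  have hL : Integrable (fun ω => (L ω).real (Set.Iic t)) P := by
    have h1 := (((h.radialMoment_expansion hβ 0 t).1.sub (h.integrable_radial 1 t)).add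
      (h.integrable_radial 1 0)).const_mul (1 / 2)
    refine h1.congr (ae_of_all _ fun ω => ?_)
    simp only [Pi.add_apply, Pi.sub_apply, Nat.cast_zero, zero_add, pow_one]
    ring
  have key : ∀ k : ℕ, radialMoment P X (k + 1) t - radialMoment P X (k + 1) 0 +
      2 * (k + 1) * ∫ ω, (L ω).real (Set.Iic t) ∂P =
      2 / β * ((k + 1) * (n + 2 * k)) * ∫ s in (0 : ℝ)..t, radialMoment P X k s.toNNReal := by
    intro k
    have hd : Integrable (fun ω => (‖X t ω‖ ^ 2) ^ (k + 1) - (‖X 0 ω‖ ^ 2) ^ (k + 1)) P :=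
      (h.integrable_radial _ t).sub (h.integrable_radial _ 0)
    rw [← (h.radialMoment_expansion hβ k t).2, integral_add hd (hL.const_mul _),
      integral_sub (h.integrable_radial _ t) (h.integrable_radial _ 0), integral_const_mul]
    rfl
  have hc : ∀ k, Continuous fun s : ℝ => radialMoment P X k s.toNNReal :=
    fun k => (h.continuous_radialMoment k).comp continuous_real_toNNReal
  have k0 := key 0
  have kk := key k
  have hone : ∀ s : ℝ, radialMoment P X 0 s.toNNReal = 1 := fun s => by simp [radialMoment]
  simp only [hone, intervalIntegral.integral_const, h0] at k0
  rw [h0] at kk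
  rw [intervalIntegral.integral_sub ((hc k).intervalIntegrable _ _) (by simp),
    intervalIntegral.integral_const]
  set I := ∫ s in (0 : ℝ)..t, radialMoment P X k s.toNNReal
  set ℓ := ∫ ω, (L ω).real (Set.Iic t) ∂P
  simp only [smul_eq_mul, sub_zero, Nat.cast_zero, mul_zero, add_zero, zero_add] at k0 ⊢
  have e1 : 2 / β * ((k + 1) * (n + 2 * k)) * (t * (n / (n + 2 * k))) =
      (k + 1) * (2 / β * n * t) := by
    field_simp
  rw [mul_sub, e1]
  linear_combination kk - (k + 1) * k0

/-- If the radial part of the initial law is `ν_n`, so is that of the law at every later time,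
whatever the angular part. -/
theorem IsReflectedSolution.map_norm_eq_nu [IsProbabilityMeasure P] (hn : 1 ≤ n) (hβ : 0 < β)
    (h : IsReflectedSolution β P 𝓕 W L X) (h0 : P.map (fun ω => Phi n (X 0 ω)) = nu n) (t : ℝ≥0) :
    P.map (fun ω => Phi n (X t ω)) = nu n := by
  have hn0 : (0 : ℝ) < n := by exact_mod_cast hn
  have hm : ∀ s, Measurable fun ω => Phi n (X s ω) := fun s =>
    (measurable_Phi n).comp ((h.adapted s).mono (𝓕.le s) le_rfl)
  have hmom : ∀ (k : ℕ) (s : ℝ≥0),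
      ∫ y, (y ^ 2) ^ k ∂(P.map fun ω => Phi n (X s ω)) = radialMoment P X k s := by
    intro k s
    rw [integral_map (hm s).aemeasurable (by fun_prop)]
    rfl
  have hinit : ∀ k : ℕ, radialMoment P X k 0 = n / (n + 2 * k) := by
    intro k
    rw [← hmom, h0, integral_even_pow_nu hn]
  have hfrac : ∀ k : ℕ, (n : ℝ) / (n + 2 * k) ∈ Set.Icc (0 : ℝ) 1 := fun k => by
    rw [← hinit]
    exact h.radialMoment_mem_Icc k 0
  have hzero := moment_hierarchy_eq_zero (K := 1)
    (b := fun k s => radialMoment P X k s.toNNReal - n / (n + 2 * k))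
    (c := fun k => 2 / β * ((k + 1) * (n + 2 * k)))
    (fun k => ((h.continuous_radialMoment k).comp continuous_real_toNNReal).sub continuous_const)
    (fun k s => by
      have h1 := h.radialMoment_mem_Icc k s.toNNReal
      have h2 := hfrac k
      rw [abs_le]
      constructor <;> linarith [h1.1, h1.2, h2.1, h2.2])
    (fun k => by positivity)
    (by
      refine tendsto_atTop_mono (f := fun k : ℕ => 2 / β * (k : ℝ)) (fun k => ?_)
        (tendsto_natCast_atTop_atTop.const_mul_atTop (by positivity))
      refine mul_le_mul_of_nonneg_left ?_ (by positivity)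
      have hn1 : (1 : ℝ) ≤ n := by exact_mod_cast hn
      nlinarith [(k.cast_nonneg : (0 : ℝ) ≤ k)])
    (fun s => by
      simp [radialMoment, hn0.ne'])
    (fun k s hs => by
      have := h.radialMoment_recursion hn hβ hinit k s.toNNReal
      rwa [Real.coe_toNNReal _ hs] at this)
  have : IsProbabilityMeasure (P.map fun ω => Phi n (X t ω)) :=
    Measure.isProbabilityMeasure_map (hm t).aemeasurable
  refine measure_eq_of_even_moments ?_ (nu_ae_mem_Icc hn) fun k => ?_
  · refine (ae_map_iff (hm t).aemeasurable measurableSet_Icc).2 ?_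
    filter_upwards [h.mem_ball] with ω hω using ⟨norm_nonneg _, hω t⟩
  · have := hzero k t t.coe_nonneg
    simp only [Real.toNNReal_coe] at this
    rw [hmom, integral_even_pow_nu hn]
    linarith

end

end CoarseGraining

theorem lemmal (n : ℕ) (hn : 1 ≤ n) :
    -- `ν_n` is an invariant measure of `Y = |X|`
    (∀ (β : ℝ), 0 < β → ∀ (Ω : Type*) (mΩ : MeasurableSpace Ω) (P : Measure Ω)
      (X : ℝ≥0 → Ω → EuclideanSpace ℝ (Fin n)),
      IsProbabilityMeasure P → CoarseGraining.IsReflectedFlatDiffusion β P X →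
      P.map (fun ω => CoarseGraining.Phi n (X 0 ω)) = CoarseGraining.nu n →
      ∀ t : ℝ≥0, P.map (fun ω => CoarseGraining.Phi n (X t ω)) = CoarseGraining.nu n) ∧
    -- `ν_n(dy) = c'_n exp (S_n(y)) dy` on `(0, 1)`, a probability measure
    IsProbabilityMeasure (CoarseGraining.nu n) ∧
    (∃ c' : ℝ, 0 < c' ∧ CoarseGraining.nu n =
      (volume.restrict (Set.Ioo (0 : ℝ) 1)).withDensity
        (fun y => ENNReal.ofReal (c' * Real.exp (CoarseGraining.S n y)))) ∧
    -- `S_n` is the logarithm of the Lebesgue density of `ν_n` up to a constant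
    (∃ C₁ : ℝ, ∀ᵐ y ∂(volume.restrict (Set.Ioo (0 : ℝ) 1)),
      (CoarseGraining.S n y : EReal) =
        ENNReal.log ((CoarseGraining.nu n).rnDeriv volume y) + (C₁ : EReal)) ∧
    -- `S_n` is the logarithm of the mass of the microcanonical measure up to a constant, both for
    -- the disintegration of Lebesgue measure and for the limit over shrinking shells
    (∃ C₂ : ℝ,
      (∃ δ, CoarseGraining.IsMicrocanonical (CoarseGraining.Phi n) δ) ∧
      (∀ δ, CoarseGraining.IsMicrocanonical (CoarseGraining.Phi n) δ →
        ∀ᵐ y ∂(volume.restrict (Set.Ioi (0 : ℝ))),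
          (CoarseGraining.S n y : EReal) = ENNReal.log (δ y Set.univ) + (C₂ : EReal)) ∧
      (∀ y : ℝ, 0 < y →
        (∃ m, CoarseGraining.IsMicrocanonicalAt (CoarseGraining.Phi n) y m) ∧
        (∀ m, CoarseGraining.IsMicrocanonicalAt (CoarseGraining.Phi n) y m →
          (CoarseGraining.S n y : EReal) = ENNReal.log (m Set.univ) + (C₂ : EReal)))) := by
  refine ⟨?_, inferInstance, ?_, ?_, ?_⟩
  · intro β hβ Ω mΩ P X hP hX h0 t
    obtain ⟨𝓕, W, L, h⟩ := hX
    exact h.map_norm_eq_nu hn hβ h0 t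
  · refine ⟨n, by exact_mod_cast hn, ?_⟩
    rw [CoarseGraining.nu_eq_withDensity hn]
    refine withDensity_congr_ae ?_
    filter_upwards [ae_restrict_mem measurableSet_Ioo] with y hy
    rw [CoarseGraining.exp_S hn hy.1]
  · refine ⟨-Real.log n, ?_⟩
    filter_upwards [CoarseGraining.rnDeriv_nu hn, ae_restrict_mem measurableSet_Ioo] with y hy hy1
    rw [hy]
    exact CoarseGraining.S_eq_log_add hn (by exact_mod_cast hn) hy1.1
  · refine ⟨-Real.log (CoarseGraining.sphereArea n),
      ⟨_, CoarseGraining.isMicrocanonical_sphereMeasure hn⟩, fun δ hδ => ?_,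
      fun y hy => ⟨⟨_, CoarseGraining.isMicrocanonicalAt_sphereMeasure hn hy⟩, fun m hm => ?_⟩⟩
    · filter_upwards [CoarseGraining.microcanonical_univ hn hδ,
        ae_restrict_mem measurableSet_Ioi] with y hy hy0
      rw [hy]
      exact CoarseGraining.S_eq_log_add hn (CoarseGraining.sphereArea_pos hn) hy0
    · rw [CoarseGraining.microcanonicalAt_univ hn hy hm]
      exact CoarseGraining.S_eq_log_add hn (CoarseGraining.sphereArea_pos hn) hy
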